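/- A temporal graph $\mathcal G=(V,\mathcal E,T)$ consists of a finite vertex set $V$, a lifetime $T\in\mathbb N$ and a set of time-edges $\mathcal E\subseteq\binom V2\times\{1,\dots,T\}$; its underlying graph has vertex set $V$ and edge set $\{\{u,v\} : (\{u,v\},t)\in\mathcal E\text{ for some }t\}$. For $s,z\in V$, a temporal $(s,z)$-path is a sequence $((\{v_{i-1},v_i\},t_i))_{i=1}^{k}$, $k\ge 0$, of time-edges in $\mathcal E$ with $v_0=s$, $v_k=z$, pairwise distinct vertices $v_0,\dots,v_k$, and $t_1\le t_2\le\dots\le t_k$. The problem #Temporal Path asks, given $\mathcal G$ and $s,z\in V$, for the number of temporal $(s,z)$-paths in $\mathcal G$. The feedback edge number of a graph is the minimum number of edges whose removal leaves a forest. **Theorem.** #Temporal Path is fixed-parameter tractable when parameterised by the feedback edge number of the underlying graph. That is, there are a computable function $f:\mathbb N\to\mathbb N$, a polynomial $p$ and a (deterministic) Turing machine that, for every instance $I=(\mathcal G,s,z)$, given as a word of length $|I|$ (one symbol per vertex, followed by $T$, $s$, $z$ and a list of the time-edges in arbitrary order, all numbers in binary), outputs the number of temporal $(s,z)$-paths in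 $\mathcal G$ in binary after at most $f(k)\cdot p(|I|)$ steps, where $k$ is the feedback edge number of the underlying graph of $\mathcal G$. -/

import Mathlib

/-- An undirected, simple temporal graph on the vertex set `V`: a lifetime `T` and a finite set of
time-edges `({u, v}, t)` with `u ≠ v` and `1 ≤ t ≤ T`. -/
structure TemporalGraph (V : Type*) where
  /-- the lifetime `T` -/
  lifetime : ℕ
  /-- the time-edges -/
  timeEdges : Finset (Sym2 V × ℕ)
  /-- there are no loops -/
  not_isDiag : ∀ e ∈ timeEdges, ¬ e.1.IsDiag
  /-- all labels lie in `{1, …, T}` -/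
  label_mem : ∀ e ∈ timeEdges, 1 ≤ e.2 ∧ e.2 ≤ lifetime

namespace TemporalGraph

variable {V : Type*}

/-- The underlying static graph: `u` and `v` are adjacent if `({u, v}, t)` is a time-edge for
some `t`. -/
def underlying (G : TemporalGraph V) : SimpleGraph V :=
  SimpleGraph.fromEdgeSet {e | ∃ t, (e, t) ∈ G.timeEdges}

/-- `P` is a (non-strict) temporal `(s, z)`-path: a sequence of time-edges
`({v 0, v 1}, t 1), …, ({v (k-1), v k}, t k)` with pairwise distinct vertices `v 0 = s, …, v k = z`
and non-decreasing labels. The empty sequence is a temporal `(s, s)`-path. -/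
def IsTemporalPath (G : TemporalGraph V) (s z : V) (P : List (Sym2 V × ℕ)) : Prop :=
  (∀ e ∈ P, e ∈ G.timeEdges) ∧
  (∃ v : Fin (P.length + 1) → V, v 0 = s ∧ v (Fin.last P.length) = z ∧ Function.Injective v ∧
    ∀ i : Fin P.length, (P.get i).1 = s(v i.castSucc, v i.succ)) ∧
  (P.map Prod.snd).IsChain (· ≤ ·)

/-- The number of temporal `(s, z)`-paths. -/
noncomputable def numTemporalPaths (G : TemporalGraph V) (s z : V) : ℕ :=
  {P | G.IsTemporalPath s z P}.ncard

/-- On finitely many vertices there are only finitely many temporal `(s, z)`-paths, so that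
`numTemporalPaths` is their number. -/
theorem finite_setOf_isTemporalPath [Finite V] (G : TemporalGraph V) (s z : V) :
    {P | G.IsTemporalPath s z P}.Finite := by
  have h := (List.finite_length_le (G.timeEdges : Set (Sym2 V × ℕ)) (Nat.card V)).image
    (List.map Subtype.val)
  refine h.subset ?_
  rintro P ⟨hmem, ⟨v, -, -, hv, -⟩, -⟩
  refine ⟨P.attach.map fun e => ⟨e.1, hmem e.1 e.2⟩, ?_, ?_⟩
  · have := Nat.card_le_card_of_injective v hv
    rw [Nat.card_fin] at this
    simp only [Set.mem_ofPred_eq, List.length_map, List.length_attach]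
    omega
  · rw [List.map_map]
    exact List.attach_map_subtype_val P

end TemporalGraph

/-- The feedback edge number of a graph: the least number of edges whose removal leaves a forest. -/
noncomputable def SimpleGraph.feedbackEdgeNumber {V : Type*} (G : SimpleGraph V) : ℕ :=
  sInf {k | ∃ F : Finset (Sym2 V), (F : Set (Sym2 V)) ⊆ G.edgeSet ∧ F.card = k ∧
    (G.deleteEdges (F : Set (Sym2 V))).IsAcyclic}

/-- An instance of the problem of counting temporal paths, as it is handed to an algorithm: a
temporal graph with vertices `0, …, n - 1`, two of its vertices `s` and `z`, and a presentation
of its set of time-edges by a list in arbitrary order without repetitions, each edge `{u, v}`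
being given by its two endpoints in either order. -/
structure TemporalPathInstance where
  /-- the number of vertices -/
  n : ℕ
  /-- the temporal graph -/
  graph : TemporalGraph (Fin n)
  /-- the start vertex -/
  s : Fin n
  /-- the target vertex -/
  z : Fin n
  /-- the list that presents the time-edges -/
  listing : List (Fin n × Fin n × ℕ)
  /-- no time-edge is listed twice -/
  nodup : (listing.map fun e => (s(e.1, e.2.1), e.2.2)).Nodup
  /-- the listed time-edges are exactly those of the graph -/
  mem_iff : ∀ e, e ∈ listing.map (fun e => (s(e.1, e.2.1), e.2.2)) ↔ e ∈ graph.timeEdges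

namespace TemporalPathInstance

open Computability

/-- The binary notation of a number, in the alphabet of bits, blank, comma and brackets. -/
def binary (k : ℕ) : List Γ' := (encodeNat k).map Γ'.bit

/-- The word that encodes an instance: one symbol for each vertex, followed by
`T, s, z` and, for each time-edge `({u, v}, t)`, by `u, v, t`; all of these numbers are written
in binary and preceded by a comma. -/
def encode (I : TemporalPathInstance) : List Γ' :=
  List.replicate I.n (Γ'.bit true) ++
    ([I.graph.lifetime, I.s, I.z] ++
      I.listing.flatMap fun e => [(e.1 : ℕ), (e.2.1 : ℕ), e.2.2]).flatMap
        fun k => Γ'.comma :: binary k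

/-- What has to be computed: the number of temporal `(s, z)`-paths. -/
noncomputable def count (I : TemporalPathInstance) : ℕ := I.graph.numTemporalPaths I.s I.z

/-- The parameter: the feedback edge number of the underlying graph. -/
noncomputable def feedbackEdgeNumber (I : TemporalPathInstance) : ℕ :=
  I.graph.underlying.feedbackEdgeNumber

end TemporalPathInstance

/-- The counting problem `F`, on instances `a : α` encoded as words `ea a` over the alphabet `αΓ`,
is fixed-parameter tractable for the parameter `κ`: there are a computable function `f`, a
polynomial `p` and a Turing machine which on every input `ea a` halts within
`f (κ a) * p |ea a|` steps with the binary notation of `F a` as its output. -/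
def FixedParameterTractable {α αΓ : Type} (ea : α → List αΓ) (F κ : α → ℕ) : Prop :=
  ∃ (f : ℕ → ℕ) (p : Polynomial ℕ) (M : Turing.TM2ComputableAux αΓ Bool),
    Computable f ∧
    ∀ a, Nonempty (Turing.TM2OutputsInTime M.tm
      ((ea a).map M.inputAlphabet.invFun)
      (some ((Computability.encodeNat (F a)).map M.outputAlphabet.invFun))
      (f (κ a) * p.eval (ea a).length))

/-!
# Counting temporal paths is fixed-parameter tractable in the feedback edge number

**The algorithm.** A temporal path runs along a simple path of the underlying graph. The algorithm
enumerates the simple paths that start in `s` by a search that prolongs partial paths in all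
possible ways (`PathSearch.searchStep`). With each partial path it keeps, for every label `t`, the
number of its nondecreasing labellings that end with `t`; prolonging the path by a vertex updates
these numbers by summation (`PathSearch.extend`). Whenever the path ends in `z`, the sum of these
numbers is added to the result. The search thus finds the number of temporal paths
(`PathSearch.search_eq_numTemporalPaths`).

**The number of rounds.** Each round treats one simple path from `s`. If the removal of an edge
turns the graph into one with at most `N` simple paths between any two vertices, then the graph
itself has at most `N + 2 * N ^ 2` of them, as a simple path avoids the edge or is cut in two by
it. In a forest `N = 1`, and so `N ≤ 3 ^ (2 ^ k - 1)` for feedback edge number `k`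
(`PathSearch.encard_simplePaths_le`). Hence the search takes at most `n * 3 ^ (2 ^ k - 1)` rounds.

**The machine.** Structured programs on six stacks (`StackMachine.Program`) with a big-step
semantics that bounds the number of steps (`StackMachine.Exec`) are translated to machine code
(`StackMachine.Exec.code`). On top of them, a function is `StackMachine.PolyTime` if a program
replaces the argument on the main stack by the value, in polynomial time and preserving what lies
below. Values are binary trees, written in preorder: their words are self-delimiting, so that
functions can be composed, paired and iterated (`StackMachine.PolyTime.exists_loop`). Filtering,
mapping and summing lists, comparing and adding binary numbers, and finally one round of the search
(`PathSearch.polyTime_searchStep`) are of this kind. All numbers that occur have polynomially many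
bits, up to a summand that accounts for the number of rounds (`PathSearch.iterate_searchStep`), so
the total time is polynomial in the length of the input and the number of rounds.
-/

/-! ### Structured programs on stacks -/

namespace StackMachine

open Computability Turing Function

/-- The stacks of the machine. The stack `main` holds the values that are computed with; `left`,
`right` and `counter` are auxiliary: each operation on values finds and leaves them empty. -/
inductive Stack
  | input | main | left | right | counter | output
  deriving DecidableEq

instance : Fintype Stack :=
  ⟨{.input, .main, .left, .right, .counter, .output}, fun k => by cases k <;> simp⟩

/-- The alphabet of each stack. -/
abbrev Symbol : Stack → Type
  | .input => Γ'
  | _ => Bool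

instance (k : Stack) : Fintype (Symbol k) := by
  cases k <;> (dsimp [Symbol]; infer_instance)

/-- The contents of all stacks. -/
abbrev Contents : Type := ∀ k, List (Symbol k)

/-- Structured programs. `pop k p` pops the stack `k` and goes on as told by the symbol found
(`none` if `k` is empty); `loop k p` pops `k` again and again, each time running `p` on the symbol
found, until it finds `k` empty. -/
inductive Program
  | skip
  | push (k : Stack) (a : Symbol k)
  | seq (p q : Program)
  | pop (k : Stack) (p : Option (Symbol k) → Program)
  | loop (k : Stack) (p : Symbol k → Program)

/-- `Exec p S S' n`: started with stack contents `S`, the program `p` ends with the contents `S'`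
after at most `n` steps. -/
inductive Exec : Program → Contents → Contents → ℕ → Prop
  | skip (S) : Exec .skip S S 1
  | push (k a S) : Exec (.push k a) S (update S k (a :: S k)) 1
  | seq {p q S S' S'' m n} : Exec p S S' m → Exec q S' S'' n → Exec (.seq p q) S S'' (m + n)
  | pop {k p S S' n} :
      Exec (p (S k).head?) (update S k (S k).tail) S' n → Exec (.pop k p) S S' (n + 1)
  | loop_nil {k p S} : S k = [] → Exec (.loop k p) S S 1
  | loop_cons {k p S S' S'' a l m n} : S k = a :: l → Exec (p a) (update S k l) S' m →
      Exec (.loop k p) S' S'' n → Exec (.loop k p) S S'' (m + n + 1)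
  | mono {p S S' m n} : Exec p S S' m → m ≤ n → Exec p S S' n

/-- The control points of a program. -/
def Label : Program → Type
  | .skip => Unit
  | .push _ _ => Unit
  | .seq p q => Label p ⊕ Label q
  | .pop _ p => Option (Σ a, Label (p a))
  | .loop _ p => Option (Σ a, Label (p a))

instance Label.finite : ∀ p, Finite (Label p)
  | .skip => inferInstanceAs (Finite Unit)
  | .push _ _ => inferInstanceAs (Finite Unit)
  | .seq p q =>
    have := Label.finite p
    have := Label.finite q
    inferInstanceAs (Finite (Label p ⊕ Label q))
  | .pop _ p =>
    have := fun a => Label.finite (p a)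
    inferInstanceAs (Finite (Option (Σ a, Label (p a))))
  | .loop _ p =>
    have := fun a => Label.finite (p a)
    inferInstanceAs (Finite (Option (Σ a, Label (p a))))

/-- The control point at which a program starts. -/
def start : ∀ p, Label p
  | .skip => ()
  | .push _ _ => ()
  | .seq p _ => .inl (start p)
  | .pop _ _ => none
  | .loop _ _ => none

/-- The internal memory of the machine: for each stack, the outcome of the last pop. -/
abbrev Memory : Type := ∀ k, Option (Symbol k)

/-- The machine code of a program `p` inside a machine with labels `L`: the control points of `p`
are placed by `e`, and control passes to `x` when `p` is done. -/
def code {L : Type} : ∀ p, (Label p → L) → L → Label p → TM2.Stmt Symbol L Memory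
  | .skip, _, x, _ => .goto fun _ => x
  | .push k a, _, x, _ => .push k (fun _ => a) (.goto fun _ => x)
  | .seq p q, e, _, .inl l => code p (fun l => e (.inl l)) (e (.inr (start q))) l
  | .seq _ q, e, x, .inr l => code q (fun l => e (.inr l)) x l
  | .pop k p, e, _, none =>
      .pop k (fun v o => update v k o) (.goto fun v => e (some ⟨v k, start (p (v k))⟩))
  | .pop _ p, e, x, some ⟨a, l⟩ => code (p a) (fun l => e (some ⟨a, l⟩)) x l
  | .loop k p, e, x, none =>
      .pop k (fun v o => update v k o)
        (.goto fun v => (v k).elim x fun a => e (some ⟨a, start (p a)⟩))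
  | .loop _ p, e, _, some ⟨a, l⟩ => code (p a) (fun l => e (some ⟨a, l⟩)) (e none) l

theorem iterate_step_succ {L : Type} (M : L → TM2.Stmt Symbol L Memory) (n : ℕ) (l : L)
    (v : Memory) (S : Contents) :
    (flip bind (TM2.step M))^[n + 1] (some ⟨some l, v, S⟩) =
      (flip bind (TM2.step M))^[n] (some (TM2.stepAux (M l) v S)) := rfl

/-- The machine code does what the program does, within the same time. -/
theorem Exec.code {L : Type} (M : L → TM2.Stmt Symbol L Memory) {p S S' n} (h : Exec p S S' n) :
    ∀ (e : Label p → L) (x : L), (∀ l, M (e l) = code p e x l) → ∀ v, ∃ v', ∃ m ≤ n,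
      (flip bind (TM2.step M))^[m] (some ⟨some (e (start p)), v, S⟩) =
        some ⟨some x, v', S'⟩ := by
  induction h with
  | skip S =>
    intro e x hM v
    refine ⟨v, 1, le_rfl, ?_⟩
    rw [iterate_step_succ, hM]
    rfl
  | push k a S =>
    intro e x hM v
    refine ⟨v, 1, le_rfl, ?_⟩
    rw [iterate_step_succ, hM]
    rfl
  | @seq p q S S' S'' m n _ _ ihp ihq =>
    intro e x hM v
    obtain ⟨v', a, ha, h1⟩ := ihp (fun l => e (.inl l)) _ (fun l => hM (.inl l)) v
    obtain ⟨v'', b, hb, h2⟩ := ihq (fun l => e (.inr l)) x (fun l => hM (.inr l)) v'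
    refine ⟨v'', b + a, by omega, ?_⟩
    rw [iterate_add_apply]
    exact (congrArg _ h1).trans h2
  | @pop k p S S' n _ ih =>
    intro e x hM v
    obtain ⟨v', a, ha, h1⟩ := ih (fun l => e (some ⟨_, l⟩)) x (fun l => hM (some ⟨_, l⟩))
      (update v k (S k).head?)
    refine ⟨v', a + 1, by omega, ?_⟩
    rw [iterate_step_succ, hM]
    simp only [start, StackMachine.code, TM2.stepAux]
    rw [update_self]
    exact h1
  | @loop_nil k p S h =>
    intro e x hM v
    refine ⟨update v k none, 1, le_rfl, ?_⟩
    rw [iterate_step_succ, hM]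
    simp only [start, StackMachine.code, TM2.stepAux, h]
    have hS : update S k [] = S := by rw [← h, update_eq_self]
    rw [List.tail_nil, hS, List.head?_nil, update_self]
    rfl
  | @loop_cons k p S S' S'' a l m n h _ _ ih ih' =>
    intro e x hM v
    obtain ⟨v', i, hi, h1⟩ := ih (fun l => e (some ⟨_, l⟩)) _ (fun l => hM (some ⟨_, l⟩))
      (update v k (some a))
    obtain ⟨v'', j, hj, h2⟩ := ih' e x hM v'
    refine ⟨v'', j + i + 1, by omega, ?_⟩
    rw [iterate_step_succ, hM, iterate_add_apply]
    simp only [start, StackMachine.code, TM2.stepAux, h]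
    simp only [List.head?_cons, update_self, Option.elim, List.tail_cons]
    exact (congrArg _ h1).trans h2
  | mono _ hmn ih =>
    intro e x hM v
    obtain ⟨v', a, ha, h1⟩ := ih e x hM v
    exact ⟨v', a, ha.trans hmn, h1⟩

/-- The Turing machine that runs the program `p`. Its last step clears the internal memory, as the
final configuration has to have the initial memory. -/
noncomputable def machine (p : Program) : FinTM2 :=
  letI := Fintype.ofFinite (Label p)
  { K := Stack
    k₀ := .input
    k₁ := .output
    Γ := Symbol
    Λ := Option (Label p)
    main := some (start p)
    σ := Memory
    initialState := fun _ => none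
    m := fun l => l.elim (.load (fun _ _ => none) .halt) (code p some none) }

/-- The machine of a program, with its alphabets identified. -/
noncomputable def computer (p : Program) : TM2ComputableAux Γ' Bool :=
  ⟨machine p, Equiv.refl _, Equiv.refl _⟩

/-- The stack contents, listed in the order of the declaration of the stacks. -/
def contents (i : List Γ') (m l r c o : List Bool) : Contents
  | .input => i
  | .main => m
  | .left => l
  | .right => r
  | .counter => c
  | .output => o

/-- A program that turns the input `w` into the output `u` yields a Turing machine that does. -/
theorem Exec.outputsInTime {p w u n}
    (h : Exec p (contents w [] [] [] [] []) (contents [] [] [] [] [] u) n) :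
    Nonempty (TM2OutputsInTime (computer p).tm (w.map (computer p).inputAlphabet.invFun)
      (some (u.map (computer p).outputAlphabet.invFun)) (n + 1)) := by
  obtain ⟨v, m, hm, h1⟩ := h.code (machine p).m some none (fun _ => rfl) fun _ => none
  refine ⟨⟨⟨m + 1, ?_⟩, Nat.succ_le_succ hm⟩⟩
  have hw : w.map (computer p).inputAlphabet.invFun = w := List.map_id _
  have hu : u.map (computer p).outputAlphabet.invFun = u := List.map_id _
  rw [hw, hu, add_comm, iterate_add_apply]
  have hi : initList (computer p).tm w =
      ⟨some (some (start p)), fun _ => none, contents w [] [] [] [] []⟩ := by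
    unfold initList
    congr 1
    funext k
    cases k <;> rfl
  have ho : haltList (computer p).tm u =
      ⟨none, fun _ => none, contents [] [] [] [] [] u⟩ := by
    unfold haltList
    congr 1
    funext k
    cases k <;> rfl
  rw [hi]
  exact (congrArg _ h1).trans (congrArg some ho.symm)

end StackMachine

namespace StackMachine

open Computability Turing Function

/-! ### Binary trees on the main stack -/

/-- Binary trees, the values that are computed with. -/
inductive Value
  | nil
  | cons (a b : Value)

/-- The preorder word of a tree. It tells where it ends, so that several values can be kept on one
stack, and prefixing `true` to the words of two trees pairs them. -/
def Value.word : Value → List Bool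
  | .nil => [false]
  | .cons a b => true :: (a.word ++ b.word)

theorem Value.word_length_pos (v : Value) : 0 < v.word.length := by
  cases v <;> simp [Value.word]

section Contents

variable (i : List Γ') (m l r c o : List Bool)

theorem update_input (x) :
    update (contents i m l r c o) .input x = contents x m l r c o := by
  funext k; cases k <;> rfl

theorem update_main (x) :
    update (contents i m l r c o) .main x = contents i x l r c o := by
  funext k; cases k <;> rfl

theorem update_left (x) :
    update (contents i m l r c o) .left x = contents i m x r c o := by
  funext k; cases k <;> rfl

theorem update_right (x) :
    update (contents i m l r c o) .right x = contents i m l x c o := by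
  funext k; cases k <;> rfl

theorem update_counter (x) :
    update (contents i m l r c o) .counter x = contents i m l r x o := by
  funext k; cases k <;> rfl

theorem update_output (x) :
    update (contents i m l r c o) .output x = contents i m l r c x := by
  funext k; cases k <;> rfl

theorem exec_push_main (b) :
    Exec (.push .main b) (contents i m l r c o) (contents i (b :: m) l r c o) 1 := by
  have h := Exec.push .main b (contents i m l r c o)
  rwa [update_main] at h

theorem exec_push_left (b) :
    Exec (.push .left b) (contents i m l r c o) (contents i m (b :: l) r c o) 1 := by
  have h := Exec.push .left b (contents i m l r c o)
  rwa [update_left] at h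

theorem exec_push_right (b) :
    Exec (.push .right b) (contents i m l r c o) (contents i m l (b :: r) c o) 1 := by
  have h := Exec.push .right b (contents i m l r c o)
  rwa [update_right] at h

theorem exec_push_counter (b) :
    Exec (.push .counter b) (contents i m l r c o) (contents i m l r (b :: c) o) 1 := by
  have h := Exec.push .counter b (contents i m l r c o)
  rwa [update_counter] at h

theorem exec_push_output (b) :
    Exec (.push .output b) (contents i m l r c o) (contents i m l r c (b :: o)) 1 := by
  have h := Exec.push .output b (contents i m l r c o)
  rwa [update_output] at h

variable {i m l r c o} {S S' : Contents} {n t : ℕ}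

theorem exec_pop_main {p} (h : Exec (p m.head?) (contents i m.tail l r c o) S n) :
    Exec (.pop .main p) (contents i m l r c o) S (n + 1) :=
  .pop (by rw [update_main]; exact h)

theorem exec_pop_left {p} (h : Exec (p l.head?) (contents i m l.tail r c o) S n) :
    Exec (.pop .left p) (contents i m l r c o) S (n + 1) :=
  .pop (by rw [update_left]; exact h)

theorem exec_loop_input {p a} (h : Exec (p a) (contents i m l r c o) S n)
    (h' : Exec (.loop .input p) S S' t) :
    Exec (.loop .input p) (contents (a :: i) m l r c o) S' (n + t + 1) :=
  .loop_cons rfl (by rw [update_input]; exact h) h'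

theorem exec_loop_left {p a} (h : Exec (p a) (contents i m l r c o) S n)
    (h' : Exec (.loop .left p) S S' t) :
    Exec (.loop .left p) (contents i m (a :: l) r c o) S' (n + t + 1) :=
  .loop_cons rfl (by rw [update_left]; exact h) h'

theorem exec_loop_right {p a} (h : Exec (p a) (contents i m l r c o) S n)
    (h' : Exec (.loop .right p) S S' t) :
    Exec (.loop .right p) (contents i m l (a :: r) c o) S' (n + t + 1) :=
  .loop_cons rfl (by rw [update_right]; exact h) h'

theorem exec_loop_counter {p a} (h : Exec (p a) (contents i m l r c o) S n)
    (h' : Exec (.loop .counter p) S S' t) :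
    Exec (.loop .counter p) (contents i m l r (a :: c) o) S' (n + t + 1) :=
  .loop_cons rfl (by rw [update_counter]; exact h) h'

end Contents

/-- The contents of the stacks between two operations on values. -/
abbrev mainOnly (m : List Bool) : Contents := contents [] m [] [] [] []

/-- The loop of `scan`. The height of the stack `counter` is the number of values that are still to
be removed from the main stack. -/
def scanLoop (p : Bool → Program) : Program :=
  .loop .counter fun _ => .pop .main fun
    | none => .skip
    | some b => .seq (p b)
        (if b then .seq (.push .counter true) (.push .counter true) else .skip)

/-- Remove one value from the main stack, running `p` on each symbol of its word. -/
def scan (p : Bool → Program) : Program :=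
  .seq (.push .counter true) (scanLoop p)

/-- Scanning the topmost value: `L` and `R` describe the contents of the stacks `left` and `right`
in terms of the list of symbols treated so far, the last one first. -/
theorem exec_scanLoop {p : Bool → Program} {L R : List Bool → List Bool}
    (hp : ∀ b u m c, Exec (p b) (contents [] m (L u) (R u) c [])
      (contents [] m (L (b :: u)) (R (b :: u)) c []) 1) {S n} (v : Value) :
    ∀ {u m c}, Exec (scanLoop p)
      (contents [] m (L (v.word.reverse ++ u)) (R (v.word.reverse ++ u)) c []) S n →
      Exec (scanLoop p) (contents [] (v.word ++ m) (L u) (R u) (true :: c) []) S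
        (n + 5 * v.word.length) := by
  induction v generalizing n with
  | nil =>
    intro u m c h
    exact (exec_loop_counter (exec_pop_main (.seq (hp false _ _ _) (.skip _))) h).mono
      (by simp [Value.word]; omega)
  | cons a b iha ihb =>
    intro u m c h
    simp only [Value.word, List.reverse_cons, List.reverse_append, List.append_assoc,
      List.cons_append, List.nil_append] at h ⊢
    have h1 := iha (m := b.word ++ m) (c := true :: c) (ihb h)
    refine (exec_loop_counter (exec_pop_main (.seq (hp true _ _ _)
      (.seq (exec_push_counter ..) (exec_push_counter ..)))) h1).mono ?_
    simp only [List.length_cons, List.length_append]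
    omega

theorem exec_scan {p : Bool → Program} {L R : List Bool → List Bool}
    (hp : ∀ b u m c, Exec (p b) (contents [] m (L u) (R u) c [])
      (contents [] m (L (b :: u)) (R (b :: u)) c []) 1) (v : Value) (m : List Bool) :
    Exec (scan p) (contents [] (v.word ++ m) (L []) (R []) [] [])
      (contents [] m (L v.word.reverse) (R v.word.reverse) [] []) (5 * v.word.length + 2) := by
  refine (Exec.seq (exec_push_counter ..) (exec_scanLoop hp v (n := 1) ?_)).mono (by omega)
  rw [List.append_nil]
  exact .loop_nil rfl

/-- Remove the topmost value. -/
def drop : Program := scan fun _ => .skip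

theorem exec_drop (v : Value) (m : List Bool) :
    Exec drop (mainOnly (v.word ++ m)) (mainOnly m) (5 * v.word.length + 2) :=
  exec_scan (L := fun _ => []) (R := fun _ => []) (fun _ _ _ _ => .skip _) v m

theorem exec_scan_left (v : Value) (m r : List Bool) :
    Exec (scan (.push .left)) (contents [] (v.word ++ m) [] r [] [])
      (contents [] m v.word.reverse r [] []) (5 * v.word.length + 2) :=
  exec_scan (L := fun u => u) (R := fun _ => r) (fun _ _ _ _ => exec_push_left ..) v m

theorem exec_scan_right (v : Value) (m l : List Bool) :
    Exec (scan (.push .right)) (contents [] (v.word ++ m) l [] [] [])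
      (contents [] m l v.word.reverse [] []) (5 * v.word.length + 2) :=
  exec_scan (L := fun _ => l) (R := fun u => u) (fun _ _ _ _ => exec_push_right ..) v m

theorem exec_pour_left (m l r c : List Bool) :
    Exec (.loop .left (.push .main)) (contents [] m l r c [])
      (contents [] (l.reverse ++ m) [] r c []) (2 * l.length + 1) := by
  induction l generalizing m with
  | nil => exact .loop_nil rfl
  | cons b l ih =>
    have h := exec_loop_left (exec_push_main [] m l r c [] b) (ih (b :: m))
    rw [List.reverse_cons, List.append_assoc]
    exact h.mono (by simp only [List.length_cons]; omega)

theorem exec_pour_right (m l r c : List Bool) :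
    Exec (.loop .right (.push .main)) (contents [] m l r c [])
      (contents [] (r.reverse ++ m) l [] c []) (2 * r.length + 1) := by
  induction r generalizing m with
  | nil => exact .loop_nil rfl
  | cons b r ih =>
    have h := exec_loop_right (exec_push_main [] m l r c [] b) (ih (b :: m))
    rw [List.reverse_cons, List.append_assoc]
    exact h.mono (by simp only [List.length_cons]; omega)

theorem exec_pour_right_left (m l r c : List Bool) :
    Exec (.loop .right (.push .left)) (contents [] m l r c [])
      (contents [] m (r.reverse ++ l) [] c []) (2 * r.length + 1) := by
  induction r generalizing l with
  | nil => exact .loop_nil rfl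
  | cons b r ih =>
    have h := exec_loop_right (exec_push_left [] m l r c [] b) (ih (b :: l))
    rw [List.reverse_cons, List.append_assoc]
    exact h.mono (by simp only [List.length_cons]; omega)

theorem exec_pour_left_twice (m l r c : List Bool) :
    Exec (.loop .left fun b => .seq (.push .main b) (.push .right b)) (contents [] m l r c [])
      (contents [] (l.reverse ++ m) [] (l.reverse ++ r) c []) (3 * l.length + 1) := by
  induction l generalizing m r with
  | nil => exact .loop_nil rfl
  | cons b l ih =>
    have h := exec_loop_left (.seq (exec_push_main [] m l r c [] b)
      (exec_push_right [] (b :: m) l r c [] b)) (ih (b :: m) (b :: r))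
    rw [List.reverse_cons, List.append_assoc, List.append_assoc]
    exact h.mono (by simp only [List.length_cons]; omega)

/-- Exchange the two topmost values. -/
def swap : Program :=
  .seq (scan (.push .left)) (.seq (scan (.push .right))
    (.seq (.loop .left (.push .main)) (.loop .right (.push .main))))

theorem exec_swap (v w : Value) (m : List Bool) :
    Exec swap (mainOnly (v.word ++ (w.word ++ m))) (mainOnly (w.word ++ (v.word ++ m)))
      (7 * v.word.length + 7 * w.word.length + 6) := by
  have h1 := exec_scan_left v (w.word ++ m) []
  have h2 := exec_scan_right w m v.word.reverse
  have h3 := exec_pour_left m v.word.reverse w.word.reverse []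
  have h4 := exec_pour_right (v.word ++ m) [] w.word.reverse []
  rw [List.reverse_reverse] at h3 h4
  refine (Exec.seq h1 (.seq h2 (.seq h3 h4))).mono ?_
  simp only [List.length_reverse]
  omega

/-- Copy the topmost value. -/
def dup : Program :=
  .seq (scan (.push .left))
    (.seq (.loop .left fun b => .seq (.push .main b) (.push .right b))
      (.seq (.loop .right (.push .left)) (.loop .left (.push .main))))

theorem exec_dup (v : Value) (m : List Bool) :
    Exec dup (mainOnly (v.word ++ m)) (mainOnly (v.word ++ (v.word ++ m)))
      (12 * v.word.length + 5) := by
  have h1 := exec_scan_left v m []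
  have h2 := exec_pour_left_twice m v.word.reverse [] []
  have h3 := exec_pour_right_left (v.word ++ m) [] v.word []
  have h4 := exec_pour_left (v.word ++ m) v.word.reverse [] []
  rw [List.reverse_reverse] at h2 h4
  rw [List.append_nil] at h2 h3
  refine (Exec.seq h1 (.seq h2 (.seq h3 h4))).mono ?_
  simp only [List.length_reverse]
  omega

/-- Push a given word. -/
def pushWord : List Bool → Program
  | [] => .skip
  | b :: w => .seq (pushWord w) (.push .main b)

theorem exec_pushWord (w m : List Bool) :
    Exec (pushWord w) (mainOnly m) (mainOnly (w ++ m)) (w.length + 1) := by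
  induction w with
  | nil => exact .skip _
  | cons b w ih => exact .seq ih (exec_push_main ..)

end StackMachine

namespace StackMachine

open Computability Turing Function

/-! ### Functions computable in polynomial time -/

/-- A function that is bounded by a polynomial. -/
@[fun_prop]
def PolyBounded (g : ℕ → ℕ) : Prop := ∃ c, ∀ n, g n ≤ (n + 2) ^ c

namespace PolyBounded

variable {f g : ℕ → ℕ}

theorem of_le (hg : PolyBounded g) (h : ∀ n, f n ≤ g n) : PolyBounded f := by
  obtain ⟨c, hc⟩ := hg
  exact ⟨c, fun n => (h n).trans (hc n)⟩

@[fun_prop]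
theorem id : PolyBounded fun n => n := ⟨1, fun n => by simp⟩

@[fun_prop]
theorem const (k : ℕ) : PolyBounded fun _ => k :=
  ⟨k, fun n => (Nat.lt_two_pow_self.le).trans (Nat.pow_le_pow_left (by omega) k)⟩

@[fun_prop]
theorem mul (hf : PolyBounded f) (hg : PolyBounded g) : PolyBounded fun n => f n * g n := by
  obtain ⟨a, ha⟩ := hf
  obtain ⟨b, hb⟩ := hg
  exact ⟨a + b, fun n => by rw [pow_add]; exact Nat.mul_le_mul (ha n) (hb n)⟩

@[fun_prop]
theorem add (hf : PolyBounded f) (hg : PolyBounded g) : PolyBounded fun n => f n + g n := by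
  obtain ⟨a, ha⟩ := hf
  obtain ⟨b, hb⟩ := hg
  refine ⟨max a b + 1, fun n => ?_⟩
  have h1 : (n + 2) ^ a ≤ (n + 2) ^ max a b := Nat.pow_le_pow_right (by omega) (le_max_left _ _)
  have h2 : (n + 2) ^ b ≤ (n + 2) ^ max a b := Nat.pow_le_pow_right (by omega) (le_max_right _ _)
  have h3 : (n + 2) ^ max a b * 2 ≤ (n + 2) ^ max a b * (n + 2) :=
    Nat.mul_le_mul_left _ (by omega)
  have := ha n
  have := hb n
  rw [pow_succ]
  dsimp only
  omega

@[fun_prop]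
theorem pow (hf : PolyBounded f) (k : ℕ) : PolyBounded fun n => f n ^ k := by
  induction k with
  | zero => simpa using const 1
  | succ k ih => simpa only [pow_succ] using ih.mul hf

@[fun_prop]
theorem comp (hf : PolyBounded f) (hg : PolyBounded g) : PolyBounded fun n => f (g n) := by
  obtain ⟨a, ha⟩ := hf
  exact of_le (by fun_prop : PolyBounded fun n => (g n + 2) ^ a) fun n => ha (g n)

end PolyBounded

/-- Types whose elements are represented by values. Different elements may have the same
representation; programs only see the latter. -/
class Data (α : Type) where
  /-- the value that represents an element -/
  value : α → Value


/-- The word on the main stack that represents an element. -/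
def word {α : Type} [Data α] (a : α) : List Bool := (Data.value a).word

/-- The length of the representation of an element. -/
def size {α : Type} [Data α] (a : α) : ℕ := (word a).length

instance : Data Bool := ⟨fun b => if b then .cons .nil .nil else .nil⟩

instance {α β : Type} [Data α] [Data β] : Data (α × β) :=
  ⟨fun x => .cons (Data.value x.1) (Data.value x.2)⟩

instance {α : Type} [Data α] : Data (List α) :=
  ⟨fun l => l.foldr (fun a v => .cons (Data.value a) v) .nil⟩

/-- Numbers are represented by the lists of their binary digits, the least significant one
first. -/
instance : Data ℕ := ⟨fun n => Data.value (encodeNat n)⟩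

section size

variable {α β : Type} [Data α] [Data β]

theorem size_pos (a : α) : 0 < size a := Value.word_length_pos _

theorem word_prod (x : α × β) : word x = true :: (word x.1 ++ word x.2) := rfl

theorem word_cons (a : α) (l : List α) : word (a :: l) = true :: (word a ++ word l) := rfl

theorem word_nat (n : ℕ) : word n = word (encodeNat n) := rfl

theorem size_nat (n : ℕ) : size n = size (encodeNat n) := rfl

theorem size_bool_le (b : Bool) : size b ≤ 3 := by cases b <;> decide

theorem size_prod (x : α × β) : size x = size x.1 + size x.2 + 1 := by
  simp [size, word_prod]

theorem size_mk (a : α) (b : β) : size (a, b) = size a + size b + 1 := size_prod _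

theorem size_nil : size ([] : List α) = 1 := rfl

theorem size_cons (a : α) (l : List α) : size (a :: l) = size a + size l + 1 := by
  simp [size, word_cons]

theorem length_lt_size (l : List α) : l.length < size l := by
  induction l with
  | nil => simp [size_nil]
  | cons a l ih => rw [size_cons, List.length_cons]; omega

theorem size_lt_of_mem {l : List α} {a : α} (h : a ∈ l) : size a < size l := by
  induction l with
  | nil => simp at h
  | cons b l ih =>
    rw [size_cons]
    rcases List.mem_cons.1 h with rfl | h
    · omega
    · have := ih h
      omega

theorem size_list_le {l : List α} {k : ℕ} (h : ∀ a ∈ l, size a ≤ k) :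
    size l ≤ l.length * (k + 1) + 1 := by
  induction l with
  | nil => simp [size_nil]
  | cons b l ih =>
    have h1 := ih fun a ha => h a (List.mem_cons_of_mem _ ha)
    have h2 := h b List.mem_cons_self
    rw [size_cons, List.length_cons, add_mul]
    omega

theorem size_le_of_sublist {l l' : List α} (h : l.Sublist l') : size l ≤ size l' := by
  induction h with
  | slnil => rfl
  | cons a _ ih => rw [size_cons]; omega
  | cons_cons a _ ih => rw [size_cons, size_cons]; omega

end size

/-- `f` is computed in polynomial time by a program that replaces the topmost value of the main
stack. -/
def PolyTime {α β : Type} [Data α] [Data β] (f : α → β) : Prop :=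
  ∃ (p : Program) (c : ℕ), ∀ a, size (f a) ≤ (size a + 2) ^ c ∧
    ∀ m, Exec p (mainOnly (word a ++ m)) (mainOnly (word (f a) ++ m)) ((size a + 2) ^ c)

namespace PolyTime

variable {α β γ δ : Type} [Data α] [Data β] [Data γ] [Data δ]

theorem intro {f : α → β} (p : Program) (s t : ℕ → ℕ) (hs : PolyBounded s) (ht : PolyBounded t)
    (h : ∀ a, size (f a) ≤ s (size a) ∧
      ∀ m, Exec p (mainOnly (word a ++ m)) (mainOnly (word (f a) ++ m)) (t (size a))) :
    PolyTime f := by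
  obtain ⟨c, hc⟩ := hs.add ht
  refine ⟨p, c, fun a => ⟨(h a).1.trans ?_, fun m => ((h a).2 m).mono ?_⟩⟩ <;>
  · have := hc (size a)
    dsimp only at this
    omega

/-- The bounds, as functions of the size alone. -/
theorem elim {f : α → β} (hf : PolyTime f) : ∃ (p : Program) (t : ℕ → ℕ), PolyBounded t ∧
    Monotone t ∧ ∀ a, size (f a) ≤ t (size a) ∧
      ∀ m, Exec p (mainOnly (word a ++ m)) (mainOnly (word (f a) ++ m)) (t (size a)) := by
  obtain ⟨p, c, h⟩ := hf
  exact ⟨p, fun n => (n + 2) ^ c, by fun_prop,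
    fun a b hab => Nat.pow_le_pow_left (by omega) c, h⟩

/-- Computability in polynomial time only depends on the representation of the values. -/
theorem of_word_eq {f : α → β} {g : α → γ} (hf : PolyTime f) (h : ∀ a, word (g a) = word (f a)) :
    PolyTime g := by
  obtain ⟨p, c, hp⟩ := hf
  refine ⟨p, c, fun a => ?_⟩
  rw [h a, size, h a]
  exact hp a

theorem id : PolyTime fun a : α => a :=
  intro .skip (fun n => n) (fun _ => 1) (by fun_prop) (by fun_prop)
    fun a => ⟨le_rfl, fun _ => .skip _⟩

theorem const (b : β) : PolyTime fun _ : α => b := by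
  refine intro (.seq drop (pushWord (word b))) (fun _ => size b)
    (fun n => 5 * n + 2 + (size b + 1)) (by fun_prop) (by fun_prop) fun a => ⟨le_rfl, fun m => ?_⟩
  exact (exec_drop (Data.value a) m).seq (exec_pushWord (word b) m)

theorem comp {f : β → γ} {g : α → β} (hf : PolyTime f) (hg : PolyTime g) :
    PolyTime fun a => f (g a) := by
  obtain ⟨p, s, hs, hs', hp⟩ := hf.elim
  obtain ⟨q, t, ht, ht', hq⟩ := hg.elim
  refine intro (.seq q p) (fun n => s (t n)) (fun n => t n + s (t n)) (hs.comp ht)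
    (ht.add (hs.comp ht)) fun a => ⟨(hp _).1.trans (hs' (hq a).1), fun m => ?_⟩
  exact (((hq a).2 m).seq ((hp _).2 m)).mono (by have := hs' (hq a).1; omega)

theorem pair {f : α → β} {g : α → γ} (hf : PolyTime f) (hg : PolyTime g) :
    PolyTime fun a => (f a, g a) := by
  obtain ⟨p, s, hs, hs', hp⟩ := hf.elim
  obtain ⟨q, t, ht, ht', hq⟩ := hg.elim
  refine intro (.seq dup (.seq q (.seq swap (.seq p (.push .main true))))) (fun n => s n + t n + 1)
    (fun n => 12 * n + 5 + (t n + (7 * t n + 7 * n + 6 + (s n + 1)))) (by fun_prop) (by fun_prop)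
    fun a => ⟨?_, fun m => ?_⟩
  · have := (hp a).1
    have := (hq a).1
    rw [size_mk]
    omega
  · have h1 := exec_dup (Data.value a) m
    have h2 := (hq a).2 (word a ++ m)
    have h3 := exec_swap (Data.value (g a)) (Data.value a) m
    have h4 := (hp a).2 (word (g a) ++ m)
    have h5 := exec_push_main [] (word (f a) ++ (word (g a) ++ m)) [] [] [] [] true
    have := (hq a).1
    rw [word_prod, List.cons_append, List.append_assoc]
    refine (h1.seq (h2.seq (h3.seq (h4.seq h5)))).mono ?_
    simp only [size, word] at *
    omega

theorem fst : PolyTime (Prod.fst : α × β → α) := by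
  refine intro (.pop .main fun _ => .seq swap drop) (fun n => n) (fun n => 12 * n + 9)
    (by fun_prop) (by fun_prop) fun x => ⟨by rw [size_prod]; omega, fun m => ?_⟩
  rw [word_prod, List.cons_append, List.append_assoc, size_prod]
  refine (exec_pop_main ((exec_swap (Data.value x.1) (Data.value x.2) m).seq
    (exec_drop (Data.value x.2) (word x.1 ++ m)))).mono ?_
  simp only [size, word]
  omega

theorem snd : PolyTime (Prod.snd : α × β → β) := by
  refine intro (.pop .main fun _ => drop) (fun n => n) (fun n => 5 * n + 3)
    (by fun_prop) (by fun_prop) fun x => ⟨by rw [size_prod]; omega, fun m => ?_⟩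
  rw [word_prod, List.cons_append, List.append_assoc, size_prod]
  refine (exec_pop_main (exec_drop (Data.value x.1) (word x.2 ++ m))).mono ?_
  simp only [size, word]
  omega

theorem fst' {f : α → β × γ} (hf : PolyTime f) : PolyTime fun a => (f a).1 := fst.comp hf

theorem snd' {f : α → β × γ} (hf : PolyTime f) : PolyTime fun a => (f a).2 := snd.comp hf

theorem ite {c : α → Bool} {f g : α → β} (hc : PolyTime c) (hf : PolyTime f) (hg : PolyTime g) :
    PolyTime fun a => if c a then f a else g a := by
  obtain ⟨p, s, hs, hs', hp⟩ := hf.elim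
  obtain ⟨q, t, ht, ht', hq⟩ := hg.elim
  obtain ⟨r, u, hu, hu', hr⟩ := hc.elim
  refine intro (.seq dup (.seq r (.pop .main fun
      | some true => .seq drop (.seq drop p)
      | _ => q))) (fun n => s n + t n)
    (fun n => 12 * n + 5 + (u n + (14 + (s n + t n) + 1))) (by fun_prop) (by fun_prop)
    fun a => ⟨?_, fun m => ?_⟩
  · have := (hp a).1
    have := (hq a).1
    split <;> omega
  · have h1 := exec_dup (Data.value a) m
    have h2 := (hr a).2 (word a ++ m)
    have h3 := (hp a).2 m
    have h4 := (hq a).2 m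
    refine h1.seq (h2.seq ?_)
    cases c a with
    | false => exact (exec_pop_main h4).mono (by omega)
    | true =>
      exact (exec_pop_main ((exec_drop .nil _).seq ((exec_drop .nil _).seq h3))).mono
        (by simp only [Value.word, List.length_singleton]; omega)

/-- Case distinction on a list. -/
theorem listCases {l : α → List γ} {f : α → β} {g : α → γ → List γ → β} (hl : PolyTime l)
    (hf : PolyTime f) (hg : PolyTime fun x : α × γ × List γ => g x.1 x.2.1 x.2.2) :
    PolyTime fun a => List.casesOn (motive := fun _ => β) (l a) (f a) (g a) := by
  obtain ⟨p, s, hs, hs', hp⟩ := hf.elim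
  obtain ⟨q, t, ht, ht', hq⟩ := hg.elim
  obtain ⟨r, u, hu, hu', hr⟩ := hl.elim
  refine intro (.seq dup (.seq r (.pop .main fun
      | some true => .seq (.push .main true) (.seq swap (.seq (.push .main true) q))
      | _ => p))) (fun n => s n + t (n + u n + 1))
    (fun n => 12 * n + 5 + (u n + (s n + t (n + u n + 1) + 7 * u n + 7 * n + 9)))
    (by fun_prop) (by fun_prop) fun a => ⟨?_, fun m => ?_⟩
  · have h1 := (hp a).1
    have h2 := (hr a).1
    cases hla : l a with
    | nil => exact h1.trans (by omega)
    | cons b l' =>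
      refine (hq (a, b, l')).1.trans (le_add_left (ht' ?_))
      rw [hla, size_cons] at h2
      rw [size_mk, size_mk]
      omega
  · refine (exec_dup (Data.value a) m).seq (((hr a).2 (word a ++ m)).seq ?_)
    have h2 := (hr a).1
    cases hla : l a with
    | nil => exact (exec_pop_main ((hp a).2 m)).mono (by omega)
    | cons b l' =>
      rw [hla] at h2
      have h3 := exec_push_main [] (word b ++ word l' ++ (word a ++ m)) [] [] [] [] true
      have h4 := exec_swap (Data.value (b, l')) (Data.value a) m
      have h5 := exec_push_main [] (word a ++ (word (b, l') ++ m)) [] [] [] [] true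
      have h6 := (hq (a, b, l')).2 m
      rw [word_prod, List.cons_append, List.append_assoc] at h6
      have h7 : size (a, b, l') ≤ size a + u (size a) + 1 := by
        rw [size_cons] at h2
        rw [size_mk, size_mk]
        omega
      have h8 := ht' h7
      have h9 : size (b, l') = size (b :: l') := rfl
      refine (exec_pop_main (h3.seq (h4.seq (h5.seq h6)))).mono ?_
      simp only [size, word] at *
      omega

end PolyTime

end StackMachine

namespace StackMachine

open Computability Turing Function

namespace PolyTime

variable {α β γ δ : Type} [Data α] [Data β] [Data γ] [Data δ]

theorem of_eq {f g : α → β} (hf : PolyTime f) (h : ∀ a, g a = f a) : PolyTime g :=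
  hf.of_word_eq fun a => by rw [h]

theorem cons {f : α → β} {g : α → List β} (hf : PolyTime f) (hg : PolyTime g) :
    PolyTime fun a => f a :: g a :=
  (hf.pair hg).of_word_eq fun _ => rfl

theorem isEmpty {l : α → List β} (hl : PolyTime l) : PolyTime fun a => (l a).isEmpty :=
  (hl.listCases (const true) (const false)).of_eq fun a => by cases l a <;> rfl

theorem tail {l : α → List β} (hl : PolyTime l) : PolyTime fun a => (l a).tail :=
  (hl.listCases (const []) (snd.comp snd)).of_eq fun a => by cases l a <;> rfl

theorem headD {l : α → List β} {d : α → β} (hl : PolyTime l) (hd : PolyTime d) :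
    PolyTime fun a => (l a).headD (d a) :=
  (hl.listCases hd (fst.comp snd)).of_eq fun a => by cases l a <;> rfl

theorem not {c : α → Bool} (hc : PolyTime c) : PolyTime fun a => !c a :=
  (hc.ite (const false) (const true)).of_eq fun a => by cases c a <;> rfl

theorem and {c d : α → Bool} (hc : PolyTime c) (hd : PolyTime d) : PolyTime fun a => c a && d a :=
  (hc.ite hd (const false)).of_eq fun a => by cases c a <;> rfl

theorem or {c d : α → Bool} (hc : PolyTime c) (hd : PolyTime d) : PolyTime fun a => c a || d a :=
  (hc.ite (const true) hd).of_eq fun a => by cases c a <;> rfl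

/-- A loop whose body and condition are computed in polynomial time takes time polynomial in the
largest size reached, for each round. -/
theorem exists_loop {c : α → Bool} {f : α → α} (hc : PolyTime c) (hf : PolyTime f) :
    ∃ (p : Program) (t : ℕ → ℕ), PolyBounded t ∧ Monotone t ∧ ∀ (N B : ℕ) (a : α),
      (∀ i < N, c (f^[i] a) = true) → c (f^[N] a) = false → (∀ i ≤ N, size (f^[i] a) ≤ B) →
      ∀ m, Exec p (mainOnly (word a ++ m)) (mainOnly (word (f^[N] a) ++ m)) ((N + 1) * t B) := by
  obtain ⟨p, s, hs, hs', hp⟩ := hf.elim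
  obtain ⟨r, u, hu, hu', hr⟩ := hc.elim
  let body : Program := .seq dup (.seq r (.pop .main fun
      | some true => .seq drop (.seq drop (.seq p (.push .counter true)))
      | _ => .skip))
  let t : ℕ → ℕ := fun n => 12 * n + u n + s n + 24
  have key : ∀ (N B : ℕ) (a : α),
      (∀ i < N, c (f^[i] a) = true) → c (f^[N] a) = false → (∀ i ≤ N, size (f^[i] a) ≤ B) →
      ∀ m, Exec (.loop .counter fun _ => body) (contents [] (word a ++ m) [] [] [true] [])
        (mainOnly (word (f^[N] a) ++ m)) ((N + 1) * t B + 1) := by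
    intro N
    induction N with
    | zero =>
      intro B a _ hN hB m
      have h0 : size a ≤ B := hB 0 le_rfl
      have h1 := exec_dup (Data.value a) m
      have h2 := (hr a).2 (word a ++ m)
      have h0' := hu' h0
      rw [show c a = false from hN] at h2
      refine (exec_loop_counter (h1.seq (h2.seq (exec_pop_main (.skip _)))) (.loop_nil rfl)).mono ?_
      simp only [size, word, t, zero_add, one_mul] at *
      omega
    | succ N ih =>
      intro B a hlt hN hB m
      have h0 : size a ≤ B := hB 0 (by omega)
      have h1 := exec_dup (Data.value a) m
      have h2 := (hr a).2 (word a ++ m)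
      have h0' := hu' h0
      have h0'' := hs' h0
      rw [show c a = true from hlt 0 (by omega)] at h2
      have h3 := (hp a).2 m
      have h4 := exec_push_counter [] (word (f a) ++ m) [] [] [] [] true
      have h5 := ih B (f a) (fun i hi => hlt (i + 1) (by omega)) hN
        (fun i hi => hB (i + 1) (by omega)) m
      refine (exec_loop_counter (h1.seq (h2.seq (exec_pop_main ((exec_drop .nil _).seq
        ((exec_drop .nil _).seq (h3.seq h4)))))) h5).mono ?_
      rw [add_mul (N + 1) 1, one_mul]
      simp only [size, word, t, Value.word, List.length_singleton] at *
      omega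
  refine ⟨.seq (.push .counter true) (.loop .counter fun _ => body), fun n => t n + 2,
    by fun_prop, ?_, fun N B a h1 h2 h3 m => ?_⟩
  · intro a b hab
    have := hu' hab
    have := hs' hab
    simp only [t]
    omega
  · refine ((exec_push_counter ..).seq (key N B a h1 h2 h3 m)).mono ?_
    have : (N + 1) * (t B + 2) = (N + 1) * t B + (N + 1) * 2 := mul_add ..
    dsimp only
    omega

/-- A fold whose intermediate results stay polynomially small. -/
theorem foldl_of_size_le {l : α → List β} {s : α → γ} {f : α → γ → β → γ} (hl : PolyTime l)
    (hs : PolyTime s) (hf : PolyTime fun x : α × γ × β => f x.1 x.2.1 x.2.2) {g : ℕ → ℕ}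
    (hg : PolyBounded g)
    (h : ∀ a l₁ l₂, l a = l₁ ++ l₂ → size (l₁.foldl (f a) (s a)) ≤ g (size a)) :
    PolyTime fun a => (l a).foldl (f a) (s a) := by
  let step : (α × γ) × List β → (α × γ) × List β := fun x =>
    List.casesOn (motive := fun _ => (α × γ) × List β) x.2 x
      fun b l => ((x.1.1, f x.1.1 x.1.2 b), l)
  have hstep : PolyTime step :=
    snd.listCases id
      (((fst.comp (fst.comp fst)).pair
        (hf.comp ((fst.comp (fst.comp fst)).pair ((snd.comp (fst.comp fst)).pair
          (fst.comp snd))))).pair (snd.comp snd))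
  have hiter : ∀ (l₁ l₂ : List β) (a : α) (s : γ),
      step^[l₁.length] ((a, s), l₁ ++ l₂) = ((a, l₁.foldl (f a) s), l₂) := by
    intro l₁
    induction l₁ with
    | nil => intros; rfl
    | cons b l₁ ih => intro l₂ a s; exact ih l₂ a (f a s b)
  obtain ⟨p, t, ht, ht', hp⟩ := exists_loop (c := fun x : (α × γ) × List β => !x.2.isEmpty)
    snd.isEmpty.not hstep
  obtain ⟨q, u, hu, hu', hq⟩ := hl.elim
  obtain ⟨r, v, hv, hv', hr⟩ := ((id.pair hs).pair hl).elim
  have hB : ∀ (a : α) i, i ≤ (l a).length →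
      size (step^[i] ((a, s a), l a)) ≤ size a + g (size a) + u (size a) + 2 := by
    intro a i hi
    have h1 := hiter ((l a).take i) ((l a).drop i) a (s a)
    rw [List.take_append_drop, List.length_take, min_eq_left hi] at h1
    have h2 := h a ((l a).take i) ((l a).drop i) (List.take_append_drop ..).symm
    have h3 := size_le_of_sublist (List.drop_sublist i (l a))
    have h4 := (hq a).1
    rw [h1, size_mk, size_mk]
    omega
  have hfin : PolyTime fun a => ((a, (l a).foldl (f a) (s a)), ([] : List β)) := by
    refine intro (.seq r p) (fun n => n + g n + u n + 2)
      (fun n => v n + (u n + 1) * t (n + g n + u n + 2)) (by fun_prop) (by fun_prop)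
      fun a => ?_
    have h1 := hiter (l a) [] a (s a)
    rw [List.append_nil] at h1
    refine ⟨by simpa only [h1] using hB a _ le_rfl, fun m => ?_⟩
    have h2 := hp (l a).length _ ((a, s a), l a) (fun i hi => ?_) (by rw [h1]; rfl) (hB a) m
    · rw [h1] at h2
      refine (((hr a).2 m).seq h2).mono (Nat.add_le_add_left (Nat.mul_le_mul_right _ ?_) _)
      have := (hq a).1
      have := length_lt_size (l a)
      omega
    · have h3 := hiter ((l a).take i) ((l a).drop i) a (s a)
      rw [List.take_append_drop, List.length_take, min_eq_left hi.le] at h3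
      rw [h3]
      have : 0 < ((l a).drop i).length := by rw [List.length_drop]; omega
      simpa [List.isEmpty_iff] using hi
  exact hfin.fst'.snd'

/-- A fold in which each step adds a polynomial amount to the size. -/
theorem foldl {l : α → List β} {s : α → γ} {f : α → γ → β → γ} (hl : PolyTime l)
    (hs : PolyTime s) (hf : PolyTime fun x : α × γ × β => f x.1 x.2.1 x.2.2) {g : ℕ → ℕ}
    (hg : PolyBounded g) (hg' : Monotone g)
    (h : ∀ a c b, size (f a c b) ≤ size c + g (size a + size b)) :
    PolyTime fun a => (l a).foldl (f a) (s a) := by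
  obtain ⟨_, t, ht, ht', htl⟩ := hl.elim
  obtain ⟨_, u, hu, hu', hus⟩ := hs.elim
  refine foldl_of_size_le hl hs hf (g := fun n => u n + t n * g (n + t n)) (by fun_prop) ?_
  intro a l₁ l₂ hla
  have h1 : size (l a) ≤ t (size a) := (htl a).1
  have h2 : size (s a) ≤ u (size a) := (hus a).1
  have h3 : ∀ (l₁ : List β) c, (∀ b ∈ l₁, size b ≤ t (size a)) →
      size (l₁.foldl (f a) c) ≤ size c + l₁.length * g (size a + t (size a)) := by
    intro l₁
    induction l₁ with
    | nil => intro c _; simp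
    | cons b l₁ ih =>
      intro c hb
      have h4 := ih (f a c b) fun x hx => hb x (List.mem_cons_of_mem _ hx)
      have h5 := h a c b
      have h6 := hg' (Nat.add_le_add_left (hb b List.mem_cons_self) (size a))
      rw [List.foldl_cons, List.length_cons, add_mul]
      omega
  have h4 : l₁.length ≤ t (size a) := by
    have := length_lt_size (l a)
    rw [hla, List.length_append] at this
    rw [hla] at h1
    omega
  refine (h3 l₁ (s a) fun b hb => ?_).trans
    (Nat.add_le_add h2 (Nat.mul_le_mul_right _ h4))
  exact (size_lt_of_mem (hla ▸ List.mem_append_left l₂ hb : b ∈ l a)).le.trans h1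

theorem reverse {l : α → List β} (hl : PolyTime l) : PolyTime fun a => (l a).reverse := by
  have h := hl.foldl (f := fun _ c b => b :: c) (const [])
    (cons (snd.comp snd) (fst.comp snd)) (g := fun n => n + 1) (by fun_prop)
    (fun a b h => Nat.succ_le_succ h) fun a c b => by rw [size_cons]; omega
  exact h.of_eq fun a => by simp

theorem foldr {l : α → List β} {s : α → γ} {f : α → β → γ → γ} (hl : PolyTime l)
    (hs : PolyTime s) (hf : PolyTime fun x : α × β × γ => f x.1 x.2.1 x.2.2) {g : ℕ → ℕ}
    (hg : PolyBounded g) (hg' : Monotone g)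
    (h : ∀ a b c, size (f a b c) ≤ size c + g (size a + size b)) :
    PolyTime fun a => (l a).foldr (f a) (s a) := by
  have h := hl.reverse.foldl (f := fun a c b => f a b c) hs
    (hf.comp (fst.pair ((snd.comp snd).pair (fst.comp snd)))) hg hg' fun a c b => h a b c
  exact h.of_eq fun a => by rw [List.foldl_reverse]

theorem append {l l' : α → List β} (hl : PolyTime l) (hl' : PolyTime l') :
    PolyTime fun a => l a ++ l' a := by
  have h := hl.foldr (f := fun _ b c => b :: c) hl'
    (cons (fst.comp snd) (snd.comp snd)) (g := fun n => n + 1) (by fun_prop)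
    (fun a b h => Nat.succ_le_succ h) fun a c b => by rw [size_cons]; omega
  exact h.of_eq fun a => by simp

theorem map {l : α → List β} {f : α → β → γ} (hl : PolyTime l)
    (hf : PolyTime fun x : α × β => f x.1 x.2) : PolyTime fun a => (l a).map (f a) := by
  obtain ⟨_, t, ht, ht', htl⟩ := hf.elim
  have h := hl.foldr (f := fun a b c => f a b :: c) (const [])
    (cons (hf.comp (fst.pair (fst.comp snd))) (snd.comp snd)) (g := fun n => t (n + 1) + 1)
    (by fun_prop) (fun a b h => Nat.succ_le_succ (ht' (Nat.succ_le_succ h))) fun a b c => by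
      have : size (f a b) ≤ t (size (a, b)) := (htl (a, b)).1
      rw [size_mk] at this
      rw [size_cons]
      omega
  exact h.of_eq fun a => by
    induction l a with
    | nil => rfl
    | cons b l ih => rw [List.map_cons, ih, List.foldr_cons]

theorem filter {l : α → List β} {f : α → β → Bool} (hl : PolyTime l)
    (hf : PolyTime fun x : α × β => f x.1 x.2) : PolyTime fun a => (l a).filter (f a) := by
  have h := hl.foldr (f := fun a b c => if f a b then b :: c else c) (const [])
    (ite (hf.comp (fst.pair (fst.comp snd))) (cons (fst.comp snd) (snd.comp snd))
      (snd.comp snd)) (g := fun n => n + 1)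
    (by fun_prop) (fun a b h => Nat.succ_le_succ h) fun a b c => by
      split
      · rw [size_cons]; omega
      · omega
  exact h.of_eq fun a => by
    induction l a with
    | nil => rfl
    | cons b l ih => rw [List.filter_cons, ih, List.foldr_cons]

end PolyTime

end StackMachine

namespace StackMachine

open Computability Turing Function

/-! ### Binary arithmetic -/

theorem encodeNat_bit (b : Bool) (n : ℕ) :
    encodeNat (Nat.bit b n) = if b || n != 0 then b :: encodeNat n else [] := by
  unfold encodeNat
  rw [← Num.ofNat'_eq, ← Num.ofNat'_eq, Num.ofNat'_bit]
  have h : n = 0 ↔ Num.ofNat' n = 0 := by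
    rw [Num.ofNat'_eq]
    simp
  cases hn : Num.ofNat' n with
  | zero =>
    have : n = 0 := h.2 hn
    subst this
    cases b <;> rfl
  | pos m =>
    have : n ≠ 0 := fun h' => by rw [h.1 h'] at hn; cases hn
    cases b <;> simp [this] <;> rfl

theorem encodeNat_zero : encodeNat 0 = [] := rfl

theorem tail_encodeNat (n : ℕ) : (encodeNat n).tail = encodeNat n.div2 := by
  conv_lhs => rw [← Nat.bit_bodd_div2 n, encodeNat_bit]
  split_ifs with h
  · rfl
  · simp only [Bool.or_eq_true, bne_iff_ne, ne_eq, not_or, not_not] at h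
    rw [h.2]
    rfl

theorem headD_encodeNat (n : ℕ) : (encodeNat n).headD false = n.bodd := by
  conv_lhs => rw [← Nat.bit_bodd_div2 n, encodeNat_bit]
  split_ifs with h
  · rfl
  · simp only [Bool.or_eq_true, not_or, Bool.not_eq_true] at h
    rw [h.1]
    rfl

theorem isEmpty_encodeNat (n : ℕ) : (encodeNat n).isEmpty = (n == 0) := by
  induction n using Nat.binaryRec' with
  | zero => rfl
  | bit b n h _ =>
    rw [encodeNat_bit]
    rcases Nat.eq_zero_or_pos n with rfl | hn
    · simp [h rfl]
    · have : n ≠ 0 := by omega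
      simp [this]

theorem foldr_encodeNat (n : ℕ) : (encodeNat n).foldr Nat.bit 0 = n := by
  induction n using Nat.binaryRec' with
  | zero => rfl
  | bit b n h ih =>
    rw [encodeNat_bit]
    rcases Nat.eq_zero_or_pos n with rfl | hn
    · simp [h rfl, encodeNat_zero]
    · have : n ≠ 0 := by omega
      simp [this, ih]

theorem length_encodeNat_le {n k : ℕ} (h : n < 2 ^ k) : (encodeNat n).length ≤ k := by
  induction k generalizing n with
  | zero =>
    have : n = 0 := by simpa using h
    simp [this, encodeNat_zero]
  | succ k ih =>
    have h1 := ih (n := n.div2) (by rw [Nat.div2_val]; omega)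
    rw [← tail_encodeNat, List.length_tail] at h1
    omega

theorem lt_two_pow_length_encodeNat (n : ℕ) : n < 2 ^ (encodeNat n).length := by
  induction n using Nat.binaryRec' with
  | zero => exact Nat.one_pos
  | bit b n h ih =>
    rw [encodeNat_bit]
    split_ifs with h'
    · rw [List.length_cons, pow_succ, Nat.bit_val]
      cases b <;> simp <;> omega
    · simp only [Bool.or_eq_true, bne_iff_ne, ne_eq, not_or, not_not] at h'
      exact absurd (h h'.2) h'.1

/-- The representation of a number has logarithmic size. -/
theorem size_nat_le {n k : ℕ} (h : n < 2 ^ k) : size n ≤ 4 * k + 1 := by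
  rw [size_nat]
  have h1 := size_list_le (l := encodeNat n) fun b _ => size_bool_le b
  have h2 := length_encodeNat_le h
  omega

theorem lt_two_pow_size (n : ℕ) : n < 2 ^ size n :=
  (lt_two_pow_length_encodeNat n).trans_le
    (Nat.pow_le_pow_right Nat.two_pos (length_lt_size (encodeNat n)).le)

theorem sum_lt_two_pow_size (l : List ℕ) : l.sum < 2 ^ size l := by
  induction l with
  | nil => decide
  | cons n l ih =>
    have h := lt_two_pow_size n
    rw [List.sum_cons, size_cons, pow_succ, pow_add]
    generalize 2 ^ size n = x at *
    generalize 2 ^ size l = y at *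
    have hx : 1 ≤ x := by omega
    have hy : 1 ≤ y := by omega
    nlinarith

theorem size_div2_le (n : ℕ) : size n.div2 ≤ size n := by
  rw [size_nat, size_nat, ← tail_encodeNat]
  exact size_le_of_sublist (List.tail_sublist _)

theorem size_bit_le (b : Bool) (n : ℕ) : size (Nat.bit b n) ≤ size n + 4 := by
  rw [size_nat, encodeNat_bit]
  have := size_bool_le b
  split_ifs
  · rw [size_cons, size_nat n]
    omega
  · rw [size_nil]
    omega

/-- One step of the schoolbook addition: from the digits of two numbers that remain to be added,
the carry, and the digits of the sum found so far, the last one first. -/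
def adderStep (x : ℕ × ℕ × Bool × List Bool) : ℕ × ℕ × Bool × List Bool :=
  (x.1.div2, x.2.1.div2, (x.1.bodd && x.2.1.bodd) || (x.2.2.1 && (x.1.bodd || x.2.1.bodd)),
    Bool.xor (Bool.xor x.1.bodd x.2.1.bodd) x.2.2.1 :: x.2.2.2)

/-- The adder is correct if it runs for enough steps. The digits found so far, put in front of what
remains to be added, always make up the same number. -/
theorem foldl_adderStep {β : Type} (l : List β) (x y : ℕ) (c : Bool) (o : List Bool)
    (h : x + y + c.toNat < 2 ^ l.length) :
    (l.foldl (fun s _ => adderStep s) (x, y, c, o)).2.2.2.foldl (fun n b => Nat.bit b n) 0 =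
      o.foldl (fun n b => Nat.bit b n) (x + y + c.toNat) := by
  induction l generalizing x y c o with
  | nil =>
    have : x + y + c.toNat = 0 := by simpa using h
    rw [this]
    rfl
  | cons b l ih =>
    have hx := Nat.bit_bodd_div2 x
    have hy := Nat.bit_bodd_div2 y
    rw [Nat.bit_val] at hx hy
    rw [List.length_cons, pow_succ] at h
    rw [List.foldl_cons, adderStep, ih]
    · rw [List.foldl_cons, Nat.bit_val]
      congr 1
      dsimp only
      generalize x.div2 = x' at *
      generalize y.div2 = y' at *
      cases hbx : x.bodd <;> cases hby : y.bodd <;> cases c <;>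
        simp [hbx, hby] at hx hy ⊢ <;> omega
    · dsimp only
      generalize x.div2 = x' at *
      generalize y.div2 = y' at *
      cases hbx : x.bodd <;> cases hby : y.bodd <;> cases c <;>
        simp [hbx, hby] at hx hy h ⊢ <;> omega

/-- One step of the comparison of the numbers with the digits `b` and those of `x.1`, from the
least significant digit on; `x.2` tells whether `≤` holds for the digits seen so far. -/
def compareStep (x : ℕ × Bool) (b : Bool) : ℕ × Bool :=
  (x.1.div2, if b then x.1.bodd && x.2 else x.1.bodd || x.2)

/-- After the last digit of the first number, what remains of the second one decides, unless it is
zero. -/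
theorem foldl_compareStep (l : List Bool) (y : ℕ) (c : Bool) :
    (((l.foldl compareStep (y, c)).1 != 0) || (l.foldl compareStep (y, c)).2) =
      decide (l.foldr Nat.bit 0 < y ∨ l.foldr Nat.bit 0 = y ∧ c = true) := by
  induction l generalizing y c with
  | nil => rcases y with - | y <;> cases c <;> simp
  | cons b l ih =>
    have hy := Nat.bit_bodd_div2 y
    rw [Nat.bit_val] at hy
    rw [List.foldl_cons, compareStep, ih, List.foldr_cons]
    generalize l.foldr Nat.bit 0 = x
    rw [Nat.bit_val]
    dsimp only
    generalize y.div2 = y' at *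
    congr 1
    cases hby : y.bodd <;> cases b <;> cases c <;> simp [hby] at hy ⊢ <;> omega

namespace PolyTime

variable {α β γ δ : Type} [Data α] [Data β] [Data γ] [Data δ] {f g : α → ℕ}

theorem encodeNat (hf : PolyTime f) : PolyTime fun a => Computability.encodeNat (f a) :=
  hf.of_word_eq fun _ => rfl

theorem div2 (hf : PolyTime f) : PolyTime fun a => (f a).div2 :=
  hf.encodeNat.tail.of_word_eq fun a => by rw [tail_encodeNat, word_nat]

theorem bodd (hf : PolyTime f) : PolyTime fun a => (f a).bodd :=
  (hf.encodeNat.headD (const false)).of_eq fun _ => (headD_encodeNat _).symm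

theorem bne_zero (hf : PolyTime f) : PolyTime fun a => f a != 0 :=
  hf.encodeNat.isEmpty.not.of_eq fun a => by rw [isEmpty_encodeNat]; rfl

theorem bit {b : α → Bool} (hb : PolyTime b) (hf : PolyTime f) :
    PolyTime fun a => Nat.bit (b a) (f a) :=
  ((hb.or hf.bne_zero).ite (hb.cons hf.encodeNat) (const [])).of_word_eq fun a => by
    rw [word_nat, encodeNat_bit]

theorem xor {b c : α → Bool} (hb : PolyTime b) (hc : PolyTime c) :
    PolyTime fun a => Bool.xor (b a) (c a) :=
  (hb.ite hc.not hc).of_eq fun a => by cases b a <;> simp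

theorem adderStep : PolyTime adderStep := by
  have hx : PolyTime fun x : ℕ × ℕ × Bool × List Bool => x.1.bodd := fst.bodd
  have hy : PolyTime fun x : ℕ × ℕ × Bool × List Bool => x.2.1.bodd := snd.fst'.bodd
  have hc : PolyTime fun x : ℕ × ℕ × Bool × List Bool => x.2.2.1 := snd.snd'.fst'
  exact fst.div2.pair (snd.fst'.div2.pair (((hx.and hy).or (hc.and (hx.or hy))).pair
    (((hx.xor hy).xor hc).cons snd.snd'.snd')))

theorem add (hf : PolyTime f) (hg : PolyTime g) : PolyTime fun a => f a + g a := by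
  have h1 : PolyTime fun a => true :: (Computability.encodeNat (f a) ++
      Computability.encodeNat (g a)) := (const true).cons (hf.encodeNat.append hg.encodeNat)
  have h2 := h1.foldl (f := fun _ s _ => StackMachine.adderStep s)
    (hf.pair (hg.pair ((const false).pair (const ([] : List Bool)))))
    (adderStep.comp snd.fst') (PolyBounded.const 6) monotone_const fun a s b => by
      have h3 := size_div2_le s.1
      have h4 := size_div2_le s.2.1
      have h5 := size_pos s.2.2.1
      rw [StackMachine.adderStep, size_mk, size_mk, size_mk, size_cons, size_prod s,
        size_prod s.2, size_prod s.2.2]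
      have h6 := size_bool_le
        ((s.1.bodd && s.2.1.bodd) || (s.2.2.1 && (s.1.bodd || s.2.1.bodd)))
      have h7 := size_bool_le (Bool.xor (Bool.xor s.1.bodd s.2.1.bodd) s.2.2.1)
      omega
  have h3 := h2.snd'.snd'.snd'.foldl (f := fun _ n b => Nat.bit b n) (const 0)
    (snd.snd'.bit snd.fst') (PolyBounded.const 4) monotone_const fun a n b => size_bit_le b n
  refine h3.of_eq fun a => ?_
  rw [foldl_adderStep]
  · rfl
  · have h4 := lt_two_pow_length_encodeNat (f a)
    have h5 := lt_two_pow_length_encodeNat (g a)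
    rw [List.length_cons, List.length_append, pow_succ, pow_add]
    generalize 2 ^ (Computability.encodeNat (f a)).length = x at *
    generalize 2 ^ (Computability.encodeNat (g a)).length = y at *
    simp only [Bool.toNat_false]
    nlinarith

theorem compareStep : PolyTime fun x : (ℕ × Bool) × Bool => compareStep x.1 x.2 := by
  have hx : PolyTime fun x : (ℕ × Bool) × Bool => x.1.1.bodd := fst.fst'.bodd
  exact fst.fst'.div2.pair (snd.ite (hx.and fst.snd') (hx.or fst.snd'))

theorem le (hf : PolyTime f) (hg : PolyTime g) : PolyTime fun a => decide (f a ≤ g a) := by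
  have h1 := hf.encodeNat.foldl (f := fun _ => StackMachine.compareStep)
    (hg.pair (const true)) (compareStep.comp (snd.fst'.pair snd.snd'))
    (PolyBounded.const 2) monotone_const fun a s b => by
      have h3 := size_div2_le s.1
      have h5 := size_pos s.2
      have h6 := size_bool_le (if b then s.1.bodd && s.2 else s.1.bodd || s.2)
      rw [StackMachine.compareStep, size_mk, size_prod s]
      omega
  refine (h1.fst'.bne_zero.or h1.snd').of_eq fun a => ?_
  rw [foldl_compareStep, foldr_encodeNat]
  simp only [and_true, le_iff_lt_or_eq]

theorem eq (hf : PolyTime f) (hg : PolyTime g) : PolyTime fun a => decide (f a = g a) :=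
  ((hf.le hg).and (hg.le hf)).of_eq fun a => by
    rw [← Bool.decide_and]
    simp only [le_antisymm_iff]

theorem sum {l : α → List ℕ} (hl : PolyTime l) : PolyTime fun a => (l a).sum := by
  obtain ⟨_, t, ht, -, htl⟩ := hl.elim
  have h := foldl_of_size_le (f := fun _ s x => s + x) hl (const 0) (snd.fst'.add snd.snd')
    (g := fun n => 4 * t n + 1) (by fun_prop) fun a l₁ l₂ h => by
      have h1 : size l₁ ≤ t (size a) :=
        (size_le_of_sublist (h ▸ List.sublist_append_left l₁ l₂ : l₁.Sublist (l a))).trans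
          (htl a).1
      have h2 := size_nat_le (sum_lt_two_pow_size l₁)
      rw [List.sum_eq_foldl] at h2
      exact h2.trans (by omega)
  exact h.of_eq fun a => List.sum_eq_foldl

end PolyTime

end StackMachine

/-! ### Searching all simple paths -/

namespace PathSearch

open StackMachine

variable {V : Type} [DecidableEq V]

/-- A partial path in the search: its last vertex, the vertices that it may still be extended to,
and pairs `(t, c)`, each standing for `c` temporal paths along it that end with the label `t`. -/
abbrev Item (V : Type) : Type := V × List V × List (ℕ × ℕ)

/-- The time-edge `e` joins `v` and `w`. -/
def joins (v w : V) (e : V × V × ℕ) : Bool :=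
  (decide (e.1 = v) && decide (e.2.1 = w)) || (decide (e.1 = w) && decide (e.2.1 = v))

/-- The numbers of temporal paths along a path to `v` that is prolonged to `w`. -/
def extend (E : List (V × V × ℕ)) (v w : V) (c : List (ℕ × ℕ)) : List (ℕ × ℕ) :=
  (E.filter (joins v w)).map fun e =>
    (e.2.2, ((c.filter fun x => decide (x.1 ≤ e.2.2)).map Prod.snd).sum)

/-- The vertices to which a partial path can be prolonged. -/
def nextVertices (E : List (V × V × ℕ)) (v : V) (R : List V) : List V :=
  R.filter fun w => !(E.filter (joins v w)).isEmpty

/-- The prolongations of a partial path by one vertex. -/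
def children (E : List (V × V × ℕ)) (x : Item V) : List (Item V) :=
  (nextVertices E x.1 x.2.1).map fun w =>
    (w, x.2.1.filter fun u => !decide (u = w), extend E x.1 w x.2.2)

/-- The number of temporal paths along a partial path, provided that it ends in `z`. -/
def weight (z : V) (x : Item V) : ℕ :=
  if decide (x.1 = z) then (x.2.2.map Prod.snd).sum else 0

theorem length_filter_ne_lt {R : List V} {w : V} (h : w ∈ R) :
    (R.filter fun u => !decide (u = w)).length < R.length :=
  List.length_filter_lt_length_iff_exists.2 ⟨w, h, by simp⟩

theorem length_of_mem_children {E : List (V × V × ℕ)} {x y : Item V} (h : y ∈ children E x) :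
    y.2.1.length < x.2.1.length := by
  obtain ⟨w, hw, rfl⟩ := List.mem_map.1 h
  exact length_filter_ne_lt (List.mem_of_mem_filter hw)

/-- The sum of `f` over the tree of all prolongations of a partial path. -/
def search (E : List (V × V × ℕ)) (f : Item V → ℕ) (x : Item V) : ℕ :=
  f x + ((children E x).attach.map fun y => search E f y.1).sum
termination_by x.2.1.length
decreasing_by exact length_of_mem_children y.2

theorem search_eq (E : List (V × V × ℕ)) (f : Item V → ℕ) (x : Item V) :
    search E f x = f x + ((children E x).map (search E f)).sum := by
  rw [search, List.attach_map_val (f := search E f)]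

/-- One step of the search. The state consists of the time-edges and the target vertex, the number
of temporal paths found so far, and the partial paths that remain to be treated. -/
def searchStep (x : (List (V × V × ℕ) × V) × ℕ × List (Item V)) :
    (List (V × V × ℕ) × V) × ℕ × List (Item V) :=
  List.casesOn (motive := fun _ => (List (V × V × ℕ) × V) × ℕ × List (Item V)) x.2.2 x
    fun y l => (x.1, x.2.1 + weight x.1.2 y, children x.1.1 y ++ l)

section PolyTime

open PolyTime

variable {α : Type} [Data α]

theorem polyTime_joins {v w : α → ℕ} {e : α → ℕ × ℕ × ℕ} (hv : PolyTime v) (hw : PolyTime w)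
    (he : PolyTime e) : PolyTime fun a => joins (v a) (w a) (e a) :=
  ((he.fst'.eq hv).and (he.snd'.fst'.eq hw)).or ((he.fst'.eq hw).and (he.snd'.fst'.eq hv))

theorem polyTime_filter_joins {E : α → List (ℕ × ℕ × ℕ)} {v w : α → ℕ} (hE : PolyTime E)
    (hv : PolyTime v) (hw : PolyTime w) : PolyTime fun a => (E a).filter (joins (v a) (w a)) :=
  hE.filter (f := fun a e => joins (v a) (w a) e)
    (polyTime_joins (hv.comp fst) (hw.comp fst) snd)

theorem polyTime_sum_snd {c : α → List (ℕ × ℕ)} (hc : PolyTime c) :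
    PolyTime fun a => ((c a).map Prod.snd).sum :=
  (hc.map (f := fun _ x => x.2) snd.snd').sum

theorem polyTime_extend {E : α → List (ℕ × ℕ × ℕ)} {v w : α → ℕ} {c : α → List (ℕ × ℕ)}
    (hE : PolyTime E) (hv : PolyTime v) (hw : PolyTime w) (hc : PolyTime c) :
    PolyTime fun a => extend (E a) (v a) (w a) (c a) := by
  refine (polyTime_filter_joins hE hv hw).map (f := fun a e => (e.2.2,
    (((c a).filter fun x => decide (x.1 ≤ e.2.2)).map Prod.snd).sum))
    (snd.snd'.snd'.pair (polyTime_sum_snd ?_))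
  exact (hc.comp fst).filter (f := fun (x : α × ℕ × ℕ × ℕ) y => decide (y.1 ≤ x.2.2.2))
    (snd.fst'.le (snd.snd'.snd'.comp fst))

theorem polyTime_children : PolyTime fun x : List (ℕ × ℕ × ℕ) × Item ℕ => children x.1 x.2 := by
  have hv : PolyTime fun x : List (ℕ × ℕ × ℕ) × Item ℕ => x.2.1 := snd.fst'
  have hR : PolyTime fun x : List (ℕ × ℕ × ℕ) × Item ℕ => x.2.2.1 := snd.snd'.fst'
  have hc : PolyTime fun x : List (ℕ × ℕ × ℕ) × Item ℕ => x.2.2.2 := snd.snd'.snd'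
  refine (hR.filter (f := fun x w => !(x.1.filter (joins x.2.1 w)).isEmpty) ?_).map
    (f := fun x w => (w, x.2.2.1.filter fun u => !decide (u = w), extend x.1 x.2.1 w x.2.2.2))
    (snd.pair (.pair ?_ ?_))
  · exact (polyTime_filter_joins (fst.comp fst) (hv.comp fst) snd).isEmpty.not
  · exact (hR.comp fst).filter (f := fun x u => !decide (u = x.2)) (snd.eq fst.snd').not
  · exact polyTime_extend (fst.comp fst) (hv.comp fst) snd (hc.comp fst)

theorem polyTime_weight : PolyTime fun x : ℕ × Item ℕ => weight x.1 x.2 :=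
  (snd.fst'.eq fst).ite (polyTime_sum_snd snd.snd'.snd') (const 0)

theorem polyTime_searchStep : PolyTime (searchStep (V := ℕ)) :=
  snd.snd'.listCases id (fst.fst'.pair ((fst.snd'.fst'.add
    (polyTime_weight.comp (fst.fst'.snd'.pair snd.fst'))).pair
      ((polyTime_children.comp (fst.fst'.fst'.pair snd.fst')).append snd.snd')))

end PolyTime

/-- The bounds that hold for all partial paths that a search through the vertices `R` meets. -/
structure Bounded (E : List (V × V × ℕ)) (s : V) (R : List V) (x : Item V) : Prop where
  vertex_mem : x.1 ∈ s :: R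
  sublist : x.2.1.Sublist R
  length_le : x.2.2.length ≤ E.length + 1
  label_mem : ∀ y ∈ x.2.2, y.1 = 0 ∨ ∃ e ∈ E, y.1 = e.2.2
  sum_le : (x.2.2.map Prod.snd).sum * (E.length + 1) ^ x.2.1.length ≤ (E.length + 1) ^ R.length

omit [DecidableEq V] in
theorem Bounded.root (E : List (V × V × ℕ)) (s : V) (R : List V) :
    Bounded E s R (s, R, [(0, 1)]) where
  vertex_mem := List.mem_cons_self
  sublist := .refl _
  length_le := by simp
  label_mem := by simp
  sum_le := by simp

theorem Bounded.child {E : List (V × V × ℕ)} {s : V} {R : List V} {x y : Item V}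
    (h : Bounded E s R x) (hy : y ∈ children E x) : Bounded E s R y := by
  have hlen := length_of_mem_children hy
  obtain ⟨w, hw, rfl⟩ := List.mem_map.1 hy
  have hwx := List.mem_of_mem_filter hw
  have hl : (E.filter (joins x.1 w)).length ≤ E.length := List.length_filter_le ..
  refine ⟨List.mem_cons_of_mem _ (h.sublist.subset hwx), List.filter_sublist.trans h.sublist,
    ?_, ?_, ?_⟩
  · simp only [extend, List.length_map]
    omega
  · intro y hy
    obtain ⟨e, he, rfl⟩ := List.mem_map.1 hy
    exact .inr ⟨e, List.mem_of_mem_filter he, rfl⟩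
  · have h1 : ((extend E x.1 w x.2.2).map Prod.snd).sum ≤
        E.length * (x.2.2.map Prod.snd).sum := by
      refine (List.sum_le_card_nsmul _ (x.2.2.map Prod.snd).sum ?_).trans ?_
      · intro n hn
        simp only [extend, List.map_map, List.mem_map, Function.comp] at hn
        obtain ⟨e, -, rfl⟩ := hn
        exact (List.filter_sublist.map _).sum_le_sum fun _ _ => Nat.zero_le _
      · rw [smul_eq_mul, extend, List.length_map, List.length_map]
        exact Nat.mul_le_mul_right _ hl
    refine le_trans ?_ h.sum_le
    dsimp only at hlen ⊢
    calc _ ≤ (E.length + 1) * (x.2.2.map Prod.snd).sum *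
          (E.length + 1) ^ (x.2.1.filter fun u => !decide (u = w)).length :=
          Nat.mul_le_mul_right _ (h1.trans (Nat.mul_le_mul_right _ (Nat.le_succ _)))
      _ = (x.2.2.map Prod.snd).sum *
          (E.length + 1) ^ ((x.2.1.filter fun u => !decide (u = w)).length + 1) := by ring
      _ ≤ _ := Nat.mul_le_mul_left _ (Nat.pow_le_pow_right (Nat.succ_pos _) hlen)

omit [DecidableEq V] in
theorem Bounded.sum_le' {E : List (V × V × ℕ)} {s : V} {R : List V} {x : Item V}
    (h : Bounded E s R x) : (x.2.2.map Prod.snd).sum ≤ (E.length + 1) ^ R.length :=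
  (Nat.le_mul_of_pos_right _ (by positivity)).trans h.sum_le

theorem Bounded.weight_le {E : List (V × V × ℕ)} {s : V} {R : List V} {x : Item V}
    (h : Bounded E s R x) (z : V) : weight z x ≤ (E.length + 1) ^ R.length := by
  unfold weight
  split
  · exact h.sum_le'
  · exact Nat.zero_le _

/-- The state of the search after `i` steps: there remain `N - i` nodes of the search tree, and the
weights of the treated ones have been summed. -/
theorem iterate_searchStep (E : List (V × V × ℕ)) (s z : V) (R : List V) (i : ℕ)
    (hi : i ≤ search E (fun _ => 1) (s, R, [(0, 1)])) :
    ∃ (a : ℕ) (l : List (Item V)), searchStep^[i] ((E, z), 0, [(s, R, [(0, 1)])]) = ((E, z), a, l) ∧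
      (∀ x ∈ l, Bounded E s R x) ∧ a ≤ i * (E.length + 1) ^ R.length ∧
      (l.map (search E fun _ => 1)).sum + i = search E (fun _ => 1) (s, R, [(0, 1)]) ∧
      a + (l.map (search E (weight z))).sum = search E (weight z) (s, R, [(0, 1)]) := by
  induction i with
  | zero => exact ⟨0, _, rfl, by simpa using Bounded.root E s R, by simp, by simp, by simp⟩
  | succ i ih =>
    obtain ⟨a, l, h1, h2, h3, h4, h5⟩ := ih (by omega)
    cases l with
    | nil => exact absurd (by simpa using h4) (Nat.ne_of_lt hi)
    | cons x l =>
      have hx := h2 x List.mem_cons_self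
      refine ⟨a + weight z x, children E x ++ l, ?_, ?_, ?_, ?_, ?_⟩
      · rw [Function.iterate_succ_apply', h1]
        rfl
      · intro y hy
        rcases List.mem_append.1 hy with hy | hy
        · exact hx.child hy
        · exact h2 y (List.mem_cons_of_mem _ hy)
      · have := hx.weight_le z
        rw [add_mul, one_mul]
        omega
      · rw [List.map_cons, List.sum_cons, search_eq] at h4
        rw [List.map_append, List.sum_append]
        omega
      · rw [List.map_cons, List.sum_cons, search_eq] at h5
        rw [List.map_append, List.sum_append]
        omega

theorem pow_length_le_two_pow {E : List (ℕ × ℕ × ℕ)} {R : List ℕ} {n : ℕ} (hE : size E ≤ n)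
    (hR : size R ≤ n) : (E.length + 1) ^ R.length ≤ 2 ^ ((n + 1) * n) := by
  have h1 := length_lt_size E
  have h2 := length_lt_size R
  calc (E.length + 1) ^ R.length ≤ (2 ^ (n + 1)) ^ R.length :=
        Nat.pow_le_pow_left ((by omega : E.length + 1 ≤ n + 1).trans Nat.lt_two_pow_self.le) _
    _ ≤ 2 ^ ((n + 1) * n) := by
        rw [← pow_mul]
        exact Nat.pow_le_pow_right Nat.two_pos (Nat.mul_le_mul_left _ (by omega))

/-- The size of a partial path is polynomial in that of the input. -/
theorem Bounded.size_le {E : List (ℕ × ℕ × ℕ)} {s : ℕ} {R : List ℕ} {x : Item ℕ}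
    (h : Bounded E s R x) {n : ℕ} (hE : size E ≤ n) (hR : size (s :: R) ≤ n) :
    size x ≤ 2 * n + (n + 1) * (n + (4 * ((n + 1) * n + 1) + 1) + 2) + 3 := by
  rw [size_prod, size_prod]
  have h1 := (size_lt_of_mem h.vertex_mem).le.trans hR
  have h2 := size_le_of_sublist h.sublist
  have h3 := length_lt_size E
  have h4 : size R ≤ n := by rw [size_cons] at hR; omega
  have h5 := length_lt_size R
  have h6 : size x.2.2 ≤ (n + 1) * (n + (4 * ((n + 1) * n + 1) + 1) + 2) + 1 := by
    refine (size_list_le (k := n + (4 * ((n + 1) * n + 1) + 1) + 1) fun y hy => ?_).trans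
      (Nat.add_le_add_right (Nat.mul_le_mul_right _ (h.length_le.trans (by omega))) 1)
    have h7 : size y.1 ≤ n := by
      rcases h.label_mem y hy with h | ⟨e, he, h⟩
      · rw [h]
        exact (size_pos E).trans_le hE
      · have h8 := size_lt_of_mem he
        rw [size_prod, size_prod] at h8
        rw [h]
        omega
    have h9 : y.2 ≤ (x.2.2.map Prod.snd).sum :=
      List.single_le_sum (fun _ _ => Nat.zero_le _) _ (List.mem_map_of_mem hy)
    have h10 : size y.2 ≤ 4 * ((n + 1) * n + 1) + 1 := by
      refine size_nat_le (lt_of_le_of_lt ((h9.trans h.sum_le').trans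
        (pow_length_le_two_pow hE h4)) ?_)
      exact Nat.pow_lt_pow_right (by omega) (by omega)
    rw [size_prod]
    omega
  omega

/-- The search is carried out by a program whose running time is polynomial in the size of the input
and the number of nodes of the search tree. -/
theorem exists_search_program : ∃ (p : Program) (q t : ℕ → ℕ), PolyBounded q ∧ PolyBounded t ∧
    Monotone t ∧ ∀ (E : List (ℕ × ℕ × ℕ)) (s z : ℕ) (R : List ℕ) (m : List Bool),
      let x : (List (ℕ × ℕ × ℕ) × ℕ) × ℕ × List (Item ℕ) := ((E, z), 0, [(s, R, [(0, 1)])])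
      let N := search E (fun _ => 1) (s, R, [(0, 1)])
      let y := ((E, z), search E (weight z) (s, R, [(0, 1)]), ([] : List (Item ℕ)))
      size y ≤ q (size x) * (N + 1) ∧
        Exec p (mainOnly (word x ++ m)) (mainOnly (word y ++ m))
          ((N + 1) * t (q (size x) * (N + 1))) := by
  obtain ⟨p, t, ht, ht', hp⟩ := PolyTime.exists_loop
    (c := fun x : (List (ℕ × ℕ × ℕ) × ℕ) × ℕ × List (Item ℕ) => !x.2.2.isEmpty)
    PolyTime.snd.snd'.isEmpty.not polyTime_searchStep
  let P : ℕ → ℕ := fun n => (n + 1) * n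
  let I : ℕ → ℕ := fun n => 2 * n + (n + 1) * (n + (4 * ((n + 1) * n + 1) + 1) + 2) + 3
  refine ⟨p, fun n => n + 4 * P n + I n + 9, t, by fun_prop, ht, ht', fun E s z R m => ?_⟩
  intro x N y
  have hsearch : ∀ (y : Item ℕ), 1 ≤ search E (fun _ => 1) y := fun y => by
    rw [search_eq]
    omega
  have hN := iterate_searchStep E s z R
  obtain ⟨a, l, h1, h2, h3, h4, h5⟩ := hN N le_rfl
  have hl : l = [] := by
    cases l with
    | nil => rfl
    | cons y l =>
      have := hsearch y
      rw [List.map_cons, List.sum_cons] at h4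
      omega
  subst hl
  have ha : a = search E (weight z) (s, R, [(0, 1)]) := by simpa using h5
  subst ha
  have hB : ∀ i ≤ N, size (searchStep^[i] x) ≤
      (size x + 4 * P (size x) + I (size x) + 9) * (N + 1) := by
    intro i hi
    obtain ⟨a, l, h1, h2, h3, h4, -⟩ := hN i hi
    have hx : size E + size z + size (s :: R) + 1 ≤ size x := by
      change _ ≤ size ((E, z), 0, [(s, R, [(0, 1)])])
      rw [size_mk (E, z), size_mk E, size_mk 0, size_cons (s, R, _), size_mk s, size_mk R,
        size_cons s]
      omega
    change _ + i = N at h4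
    have hlen : l.length ≤ N := by
      have : ∀ l : List (Item ℕ), l.length ≤ (l.map (search E fun _ => 1)).sum := by
        intro l
        induction l with
        | nil => simp
        | cons y l ih =>
          have := hsearch y
          rw [List.map_cons, List.sum_cons, List.length_cons]
          omega
      exact (this l).trans (by omega)
    have hE : size E ≤ size x := by omega
    have hR : size (s :: R) ≤ size x := by omega
    have hz : size (E, z) ≤ size x := by rw [size_mk]; omega
    generalize size x = n at hE hR hz
    have h5 : size l ≤ N * (I n + 1) + 1 :=
      (size_list_le fun y hy => (h2 y hy).size_le hE hR).trans
        (Nat.add_le_add_right (Nat.mul_le_mul_right _ hlen) 1)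
    have h6 : size a ≤ 4 * (N + P n) + 1 := by
      have hR' : size R ≤ n := by rw [size_cons] at hR; omega
      refine size_nat_le (lt_of_le_of_lt (h3.trans
        (Nat.mul_le_mul hi (pow_length_le_two_pow hE hR'))) ?_)
      rw [pow_add]
      exact Nat.mul_lt_mul_of_pos_right Nat.lt_two_pow_self (by positivity)
    rw [h1, size_mk (E, z), size_mk a]
    have h7 : (I n + 5) * N ≤ (n + 4 * P n + I n + 9) * N := Nat.mul_le_mul_right _ (by omega)
    rw [mul_add, mul_one]
    have h8 : (I n + 5) * N = N * (I n + 1) + 4 * N := by ring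
    omega
  have hNy : searchStep^[N] x = y := h1
  refine ⟨hNy ▸ hB N le_rfl, ?_⟩
  rw [← hNy]
  refine hp N _ x ?_ ?_ hB m
  · intro i hi
    obtain ⟨a, l, h1, -, -, h4, -⟩ := hN i hi.le
    rw [h1]
    cases l with
    | nil => exact absurd (by simpa using h4) hi.ne
    | cons => rfl
  · rw [hNy]
    rfl

end PathSearch

/-! ### Simple paths and feedback edge sets -/

namespace PathSearch

variable {V : Type}

/-- The simple paths from `a` to `b`, as lists of vertices. -/
def simplePaths (G : SimpleGraph V) (a b : V) : Set (List V) :=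
  {l | l.Nodup ∧ l.IsChain G.Adj ∧ l.head? = some a ∧ l.getLast? = some b}

theorem exists_walk_support {G : SimpleGraph V} {a b : V} {l : List V} (hc : l.IsChain G.Adj)
    (ha : l.head? = some a) (hb : l.getLast? = some b) : ∃ p : G.Walk a b, p.support = l := by
  have hne : l ≠ [] := by rintro rfl; simp at ha
  rw [List.head?_eq_some_head hne, Option.some_inj] at ha
  rw [List.getLast?_eq_some_getLast hne, Option.some_inj] at hb
  subst ha hb
  exact ⟨.ofSupport l hne hc, SimpleGraph.Walk.support_ofSupport hne hc⟩

theorem encard_simplePaths_le_one {G : SimpleGraph V} (hG : G.IsAcyclic) (a b : V) :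
    (simplePaths G a b).encard ≤ 1 := by
  rw [Set.encard_le_one_iff]
  rintro l l' ⟨h1, h2, h3, h4⟩ ⟨h1', h2', h3', h4'⟩
  obtain ⟨p, rfl⟩ := exists_walk_support h2 h3 h4
  obtain ⟨q, rfl⟩ := exists_walk_support h2' h3' h4'
  have := (hG.subsingleton_path a b).elim ⟨p, .mk' h1⟩ ⟨q, .mk' h1'⟩
  rw [Subtype.mk.injEq] at this
  rw [this]

/-- A simple path that is not a path after the removal of an edge is cut in two by the edge. -/
theorem simplePaths_subset (G : SimpleGraph V) (x y a b : V) :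
    let G' := G.deleteEdges {s(x, y)}
    simplePaths G a b ⊆ simplePaths G' a b ∪
      ((fun l : List V × List V => l.1 ++ l.2) '' (simplePaths G' a x ×ˢ simplePaths G' y b) ∪
        (fun l : List V × List V => l.1 ++ l.2) ''
          (simplePaths G' a y ×ˢ simplePaths G' x b)) := by
  intro G' l ⟨hnd, hc, ha, hb⟩
  by_cases hl : l.IsChain G'.Adj
  · exact .inl ⟨hnd, hl, ha, hb⟩
  rw [List.isChain_iff_forall_rel_of_append_cons_cons] at hl
  push Not at hl
  obtain ⟨u, v, l₁, l₂, rfl, huv⟩ := hl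
  have hG : G.Adj u v := List.isChain_iff_forall_rel_of_append_cons_cons.1 hc rfl
  have he : s(u, v) = s(x, y) := by
    by_contra h
    exact huv (SimpleGraph.deleteEdges_adj.2 ⟨hG, h⟩)
  have hnd' := hnd
  rw [List.nodup_append] at hnd'
  obtain ⟨hnd₁, hnd₂, hdisj⟩ := hnd'
  have huv' : u ≠ v := hG.ne
  have hu : u ∉ v :: l₂ := (List.nodup_cons.1 hnd₂).1
  have hv : v ∉ l₁ ++ [u] := by
    intro h
    rcases List.mem_append.1 h with h | h
    · exact hdisj v h v (by simp) rfl
    · exact huv' (List.mem_singleton.1 h).symm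
  have h1 : l₁ ++ [u] ∈ simplePaths G' a u := by
    refine ⟨hnd.sublist (by simp), ?_, ?_, by simp⟩
    · refine (List.IsChain.infix hc ⟨[], v :: l₂, by simp⟩).imp_of_mem_imp fun p q hp hq hpq =>
        SimpleGraph.deleteEdges_adj.2 ⟨hpq, fun h => ?_⟩
      rw [Set.mem_singleton_iff, ← he, Sym2.eq_iff] at h
      rcases h with ⟨-, rfl⟩ | ⟨rfl, -⟩ <;> exact hv ‹_›
    · cases l₁ <;> simpa using ha
  have h2 : v :: l₂ ∈ simplePaths G' v b := by
    refine ⟨hnd₂.of_cons, ?_, rfl, ?_⟩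
    · refine (List.IsChain.infix hc ⟨l₁ ++ [u], [], by simp⟩).imp_of_mem_imp fun p q hp hq hpq =>
        SimpleGraph.deleteEdges_adj.2 ⟨hpq, fun h => ?_⟩
      rw [Set.mem_singleton_iff, ← he, Sym2.eq_iff] at h
      rcases h with ⟨rfl, -⟩ | ⟨-, rfl⟩ <;> exact hu ‹_›
    · simpa using hb
  rcases Sym2.eq_iff.1 he with ⟨rfl, rfl⟩ | ⟨rfl, rfl⟩
  · exact .inr (.inl ⟨(l₁ ++ [u], v :: l₂), ⟨h1, h2⟩, by simp⟩)
  · exact .inr (.inr ⟨(l₁ ++ [u], v :: l₂), ⟨h1, h2⟩, by simp⟩)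

/-- The number of simple paths between two vertices is bounded in terms of the size of a feedback
edge set. -/
theorem encard_simplePaths_le [DecidableEq V] (F : Finset (Sym2 V)) (G : SimpleGraph V)
    (hF : (G.deleteEdges (F : Set (Sym2 V))).IsAcyclic) (a b : V) :
    (simplePaths G a b).encard ≤ ((3 ^ (2 ^ F.card - 1) : ℕ) : ℕ∞) := by
  induction F using Finset.induction generalizing G a b with
  | empty =>
    rw [Finset.coe_empty, SimpleGraph.deleteEdges_empty] at hF
    simpa using encard_simplePaths_le_one hF a b
  | insert e F he ih =>
    obtain ⟨x, y⟩ := e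
    have h1 := ih (G.deleteEdges {s(x, y)}) (by
      rw [SimpleGraph.deleteEdges_deleteEdges, ← Set.insert_eq, ← Finset.coe_insert]
      exact hF)
    refine (Set.encard_le_encard (simplePaths_subset G x y a b)).trans ?_
    rw [Finset.card_insert_of_notMem he]
    have h2 : 2 ^ (F.card + 1) - 1 = (2 ^ F.card - 1) + (2 ^ F.card - 1) + 1 := by
      have := Nat.one_le_two_pow (n := F.card)
      rw [pow_succ]
      omega
    rw [h2, pow_succ, pow_add]
    generalize 3 ^ (2 ^ F.card - 1) = n at h1 ⊢
    have h3 : ∀ a b c d, ((fun l : List V × List V => l.1 ++ l.2) ''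
        (simplePaths (G.deleteEdges {s(x, y)}) a b ×ˢ
          simplePaths (G.deleteEdges {s(x, y)}) c d)).encard ≤ ((n * n : ℕ) : ℕ∞) := by
      intro a b c d
      refine (Set.encard_image_le _ _).trans ?_
      rw [Set.encard_prod, Nat.cast_mul]
      exact mul_le_mul' (h1 a b) (h1 c d)
    refine (Set.encard_union_le _ _).trans ((add_le_add (h1 a b)
      ((Set.encard_union_le _ _).trans (add_le_add (h3 _ _ _ _) (h3 _ _ _ _)))).trans ?_)
    norm_cast
    have : n ≤ n * n := Nat.le_mul_self n
    omega

variable [DecidableEq V]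

theorem exists_of_mem_nextVertices {E : List (V × V × ℕ)} {v w : V} {R : List V}
    (h : w ∈ nextVertices E v R) : w ∈ R ∧ ∃ e ∈ E, s(e.1, e.2.1) = s(v, w) := by
  obtain ⟨h1, h2⟩ := List.mem_filter.1 h
  refine ⟨h1, ?_⟩
  rw [Bool.not_eq_true', ← Bool.not_eq_true, List.isEmpty_iff] at h2
  obtain ⟨e, he⟩ := List.exists_mem_of_ne_nil _ h2
  obtain ⟨he, hj⟩ := List.mem_filter.1 he
  refine ⟨e, he, ?_⟩
  rw [Sym2.eq_iff]
  simpa [joins] using hj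

theorem notMem_filter_ne (R : List V) (w : V) : w ∉ R.filter fun u => !decide (u = w) := by
  simp

/-- The nodes of the search tree are simple paths. -/
theorem exists_simplePaths (G : SimpleGraph V) {E : List (V × V × ℕ)}
    (hE : ∀ e ∈ E, G.Adj e.1 e.2.1) (n : ℕ) : ∀ (v : V) (R : List V) (c : List (ℕ × ℕ)),
    R.length < n → R.Nodup → v ∉ R → ∃ L : List (List V), L.Nodup ∧
      L.length = search E (fun _ => 1) (v, R, c) ∧
      ∀ l ∈ L, l.Nodup ∧ l.IsChain G.Adj ∧ l.head? = some v ∧ l ⊆ v :: R := by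
  induction n with
  | zero => intro v R c h; omega
  | succ n ih =>
    intro v R c hn hR hv
    have h1 : ∀ w, ∃ L : List (List V), w ∈ nextVertices E v R → L.Nodup ∧
        L.length = search E (fun _ => 1)
          (w, R.filter fun u => !decide (u = w), extend E v w c) ∧
        ∀ l ∈ L, l.Nodup ∧ l.IsChain G.Adj ∧ l.head? = some w ∧
          l ⊆ w :: R.filter fun u => !decide (u = w) := by
      intro w
      by_cases hw : w ∈ nextVertices E v R
      · have hwR := (exists_of_mem_nextVertices hw).1
        obtain ⟨L, hL⟩ := ih w (R.filter fun u => !decide (u = w)) (extend E v w c)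
          ((length_filter_ne_lt hwR).trans_le (by omega)) (hR.filter _) (notMem_filter_ne R w)
        exact ⟨L, fun _ => hL⟩
      · exact ⟨[], fun h => absurd h hw⟩
    choose L hL using h1
    have hsub : ∀ w ∈ nextVertices E v R, ∀ l ∈ L w, l ⊆ R := by
      intro w hw l hl u hu
      rcases List.mem_cons.1 ((hL w hw).2.2 l hl |>.2.2.2 hu) with rfl | h
      · exact (exists_of_mem_nextVertices hw).1
      · exact List.mem_of_mem_filter h
    refine ⟨[v] :: (nextVertices E v R).flatMap fun w => (L w).map (v :: ·), ?_, ?_, ?_⟩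
    · rw [List.nodup_cons, List.nodup_flatMap]
      refine ⟨?_, fun w hw => (hL w hw).1.map (List.cons_injective), ?_⟩
      · intro h
        obtain ⟨w, hw, h⟩ := List.mem_flatMap.1 h
        obtain ⟨l, hl, h⟩ := List.mem_map.1 h
        have := ((hL w hw).2.2 l hl).2.2.1
        rw [List.cons_inj_right] at h
        simp [h] at this
      · refine (hR.filter _).pairwise_of_forall_ne fun w hw w' hw' hne => ?_
        rw [Function.onFun, List.disjoint_left]
        intro l h1 h2
        obtain ⟨l₁, hl₁, rfl⟩ := List.mem_map.1 h1
        obtain ⟨l₂, hl₂, h⟩ := List.mem_map.1 h2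
        rw [List.cons_inj_right] at h
        subst h
        have h3 := ((hL w hw).2.2 l₂ hl₁).2.2.1
        have h4 := ((hL w' hw').2.2 l₂ hl₂).2.2.1
        rw [h3, Option.some_inj] at h4
        exact hne h4
    · rw [search_eq, List.length_cons, List.length_flatMap, add_comm, children, List.map_map]
      congr 2
      refine List.map_congr_left fun w hw => ?_
      rw [List.length_map, (hL w hw).2.1]
      rfl
    · intro l hl
      rcases List.mem_cons.1 hl with rfl | hl
      · simp
      · obtain ⟨w, hw, hl'⟩ := List.mem_flatMap.1 hl
        obtain ⟨l, hl₁, rfl⟩ := List.mem_map.1 hl'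
        obtain ⟨h1, h2, h3, h4⟩ := (hL w hw).2.2 l hl₁
        refine ⟨List.nodup_cons.2 ⟨fun h => hv (hsub w hw l hl₁ h), h1⟩, ?_, rfl,
          List.cons_subset_cons v (hsub w hw l hl₁)⟩
        rw [List.isChain_cons]
        refine ⟨fun u hu => ?_, h2⟩
        rw [h3, Option.mem_some_iff] at hu
        subst hu
        obtain ⟨e, he, h⟩ := (exists_of_mem_nextVertices hw).2
        rw [← SimpleGraph.mem_edgeSet, ← h]
        exact hE e he

/-- The size of the search tree is bounded by the number of vertices and the feedback edge
number. -/
theorem search_one_le [Fintype V] (G : SimpleGraph V) {E : List (V × V × ℕ)}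
    (hE : ∀ e ∈ E, G.Adj e.1 e.2.1) (v : V) (R : List V) (c : List (ℕ × ℕ)) (hR : R.Nodup)
    (hv : v ∉ R) :
    search E (fun _ => 1) (v, R, c) ≤ Fintype.card V * 3 ^ (2 ^ G.feedbackEdgeNumber - 1) := by
  classical
  obtain ⟨F, -, hF, hac⟩ : G.feedbackEdgeNumber ∈ {k | ∃ F : Finset (Sym2 V),
      (F : Set (Sym2 V)) ⊆ G.edgeSet ∧ F.card = k ∧
        (G.deleteEdges (F : Set (Sym2 V))).IsAcyclic} := by
    refine Nat.sInf_mem ⟨_, G.edgeFinset, by simp, rfl, ?_⟩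
    rw [SimpleGraph.coe_edgeFinset, SimpleGraph.deleteEdges_edgeSet, sdiff_self]
    exact SimpleGraph.isAcyclic_bot
  obtain ⟨L, h1, h2, h3⟩ := exists_simplePaths G hE _ v R c (Nat.lt_succ_self _) hR hv
  rw [← h2, ← List.toFinset_card_of_nodup h1, ← hF]
  have h4 : L.toFinset ⊆ Finset.univ.biUnion fun b =>
      L.toFinset.filter fun l => l.getLast? = some b := by
    intro l hl
    have hne : l ≠ [] := by
      rintro rfl
      simpa using (h3 _ (List.mem_toFinset.1 hl)).2.2.1
    simp only [Finset.mem_biUnion, Finset.mem_univ, true_and, Finset.mem_filter]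
    exact ⟨l.getLast hne, hl, List.getLast?_eq_some_getLast hne⟩
  refine (Finset.card_le_card h4).trans (Finset.card_biUnion_le_card_mul _ _ _ fun b _ => ?_)
  have h5 := encard_simplePaths_le F G hac v b
  rw [← Nat.cast_le (α := ℕ∞), ← Set.encard_coe_eq_coe_finsetCard]
  refine (Set.encard_le_encard fun l hl => ?_).trans h5
  simp only [Finset.coe_filter, List.mem_toFinset, Set.mem_ofPred_eq] at hl
  obtain ⟨h6, h7, h8, -⟩ := h3 l hl.1
  exact ⟨h6, h7, h8, hl.2⟩

/-- Renaming the vertices does not affect the search. -/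
theorem search_map {W : Type} [DecidableEq W] {φ : V → W} (hφ : Function.Injective φ)
    (E : List (V × V × ℕ)) {f : Item V → ℕ} {g : Item W → ℕ}
    (hfg : ∀ x : Item V, g (φ x.1, x.2.1.map φ, x.2.2) = f x) (n : ℕ) :
    ∀ x : Item V, x.2.1.length < n →
      search (E.map fun e => (φ e.1, φ e.2.1, e.2.2)) g (φ x.1, x.2.1.map φ, x.2.2) =
        search E f x := by
  have hj : ∀ v w : V, (E.map fun e => (φ e.1, φ e.2.1, e.2.2)).filter (joins (φ v) (φ w)) =
      (E.filter (joins v w)).map fun e => (φ e.1, φ e.2.1, e.2.2) := by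
    intro v w
    rw [List.filter_map]
    congr 1
    refine List.filter_congr fun e _ => ?_
    simp [joins, hφ.eq_iff]
  induction n with
  | zero => intro x h; omega
  | succ n ih =>
    intro x hx
    have hch : children (E.map fun e => (φ e.1, φ e.2.1, e.2.2)) (φ x.1, x.2.1.map φ, x.2.2) =
        (children E x).map fun x => (φ x.1, x.2.1.map φ, x.2.2) := by
      unfold children nextVertices
      rw [List.filter_map, List.map_map, List.map_map]
      simp only [Function.comp_def, hj, List.isEmpty_map]
      refine List.map_congr_left fun w _ => ?_
      refine Prod.ext rfl (Prod.ext ?_ ?_)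
      · simp only [List.filter_map, Function.comp_def, hφ.eq_iff]
      · simp only [extend, hj, List.map_map, Function.comp_def]
    rw [search_eq, search_eq, hfg, hch, List.map_map]
    congr 2
    refine List.map_congr_left fun y hy => ih y ?_
    have := length_of_mem_children hy
    omega

end PathSearch

/-! ### Counting temporal paths -/

namespace PathSearch

variable {V : Type} [DecidableEq V]

/-- `P` is a temporal path from `v` to `z` with labels at least `t` and all vertices other than `v`
in `R`. -/
def IsPathFrom (T : Finset (Sym2 V × ℕ)) (z : V) : List (Sym2 V × ℕ) → V → List V → ℕ → Prop
  | [], v, _, _ => v = z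
  | e :: P, v, R, t => ∃ w ∈ R, e.1 = s(v, w) ∧ e ∈ T ∧ t ≤ e.2 ∧
      IsPathFrom T z P w (R.filter fun u => !decide (u = w)) e.2

/-- The recursive description of temporal paths agrees with the one by sequences of vertices. -/
theorem isPathFrom_iff (T : Finset (Sym2 V × ℕ)) (z : V) (P : List (Sym2 V × ℕ)) (v : V)
    (R : List V) (t : ℕ) (hv : v ∉ R) :
    IsPathFrom T z P v R t ↔ (∀ e ∈ P, e ∈ T) ∧
      (∃ f : Fin (P.length + 1) → V, f 0 = v ∧ f (Fin.last P.length) = z ∧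
        Function.Injective f ∧ (∀ i : Fin P.length, f i.succ ∈ R) ∧
        ∀ i : Fin P.length, (P.get i).1 = s(f i.castSucc, f i.succ)) ∧
      (t :: P.map Prod.snd).IsChain (· ≤ ·) := by
  induction P generalizing v R t with
  | nil =>
    simp only [IsPathFrom]
    constructor
    · rintro rfl
      exact ⟨by simp, ⟨fun _ => v, rfl, rfl, Function.injective_of_subsingleton (α := Fin 1) _,
        fun i => i.elim0, fun i => i.elim0⟩, by simp⟩
    · rintro ⟨-, ⟨f, rfl, rfl, -⟩, -⟩
      rfl
  | cons e P ih =>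
    simp only [IsPathFrom]
    constructor
    · rintro ⟨w, hw, he, heT, ht, h⟩
      rw [ih _ _ _ (notMem_filter_ne R w)] at h
      obtain ⟨h1, ⟨f, hf0, hfl, hfi, hfR, hfe⟩, h3⟩ := h
      have hR : ∀ i, f i ∈ R := by
        intro i
        refine Fin.cases (hf0 ▸ hw) (fun i => List.mem_of_mem_filter (hfR i)) i
      refine ⟨List.forall_mem_cons.2 ⟨heT, h1⟩, ⟨Fin.cons v f, rfl, ?_, ?_, ?_, ?_⟩, ?_⟩
      · rw [← hfl]
        exact Fin.cons_succ (α := fun _ => V) v f (Fin.last P.length)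
      · rw [Fin.cons_injective_iff]
        exact ⟨by rintro ⟨i, rfl⟩; exact hv (hR i), hfi⟩
      · intro i
        exact hR i
      · intro i
        refine Fin.cases ?_ (fun i => ?_) i
        · rw [← hf0] at he
          exact he
        · exact hfe i
      · exact List.isChain_cons_cons.2 ⟨ht, h3⟩
    · rintro ⟨h1, ⟨f, hf0, hfl, hfi, hfR, hfe⟩, h3⟩
      rw [List.forall_mem_cons] at h1
      rw [List.map_cons, List.isChain_cons_cons] at h3
      have he := hfe 0
      refine ⟨f 1, hfR 0, hf0 ▸ he, h1.1, h3.1, ?_⟩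
      rw [ih _ _ _ (notMem_filter_ne R _)]
      refine ⟨h1.2, ⟨Fin.tail f, rfl, hfl, hfi.comp (Fin.succ_injective _), fun i => ?_,
        fun i => hfe i.succ⟩, h3.2⟩
      refine List.mem_filter.2 ⟨hfR i.succ, ?_⟩
      have : f i.succ.succ ≠ f 1 := fun h => by
        have := hfi h
        rw [Fin.ext_iff] at this
        simp at this
      rw [Bool.not_eq_true', decide_eq_false_iff_not]
      exact this

/-- The weighted number of temporal paths found from a partial path is linear in the numbers that
the partial path carries. -/
theorem search_weight_linear (E : List (V × V × ℕ)) (z : V) (n : ℕ) :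
    ∀ (v : V) (R : List V) (c : List (ℕ × ℕ)), R.length < n →
      search E (weight z) (v, R, c) =
        (c.map fun x => x.2 * search E (weight z) (v, R, [(x.1, 1)])).sum := by
  induction n with
  | zero => intro v R c h; omega
  | succ n ih =>
    intro v R c hR
    -- the contribution of the children, as a sum over time-edges
    have hS : ∀ c, ((children E (v, R, c)).map (search E (weight z))).sum =
        ((nextVertices E v R).map fun w => ((E.filter (joins v w)).map fun e =>
          ((c.filter fun x => decide (x.1 ≤ e.2.2)).map Prod.snd).sum *
            search E (weight z) (w, R.filter fun u => !decide (u = w), [(e.2.2, 1)])).sum).sum := by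
      intro c
      rw [children, List.map_map]
      refine congrArg _ (List.map_congr_left fun w hw => ?_)
      rw [Function.comp, ih _ _ _ ((length_filter_ne_lt (List.mem_of_mem_filter hw)).trans_le
        (Nat.lt_succ_iff.1 hR)), extend, List.map_map]
      rfl
    simp only [search_eq E (weight z) (v, R, _), hS]
    induction c with
    | nil => simp [weight]
    | cons x c ihc =>
      rw [List.map_cons, List.sum_cons, ← ihc, mul_add, add_add_add_comm]
      congr 1
      · by_cases h : v = z <;> simp [weight, h]
      · rw [← List.sum_map_mul_left, ← List.sum_map_add]
        refine congrArg _ (List.map_congr_left fun w hw => ?_)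
        rw [← List.sum_map_mul_left, ← List.sum_map_add]
        refine congrArg _ (List.map_congr_left fun e he => ?_)
        by_cases h : x.1 ≤ e.2.2 <;> simp [h, add_mul]

theorem joins_iff {v w : V} {e : V × V × ℕ} : joins v w e = true ↔ s(e.1, e.2.1) = s(v, w) := by
  rw [Sym2.eq_iff]
  simp [joins]

/-- The search counts temporal paths. -/
theorem exists_paths {E : List (V × V × ℕ)} (hE : (E.map fun e => (s(e.1, e.2.1), e.2.2)).Nodup)
    {T : Finset (Sym2 V × ℕ)} (hT : ∀ e, e ∈ E.map (fun e => (s(e.1, e.2.1), e.2.2)) ↔ e ∈ T)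
    (z : V) (n : ℕ) : ∀ (v : V) (R : List V) (t : ℕ), R.length < n → R.Nodup → v ∉ R →
      ∃ L : List (List (Sym2 V × ℕ)), L.Nodup ∧
        L.length = search E (weight z) (v, R, [(t, 1)]) ∧ ∀ P, P ∈ L ↔ IsPathFrom T z P v R t := by
  induction n with
  | zero => intro v R t h; omega
  | succ n ih =>
    intro v R t hn hR hv
    have h1 : ∀ (w : V) (t : ℕ), ∃ L : List (List (Sym2 V × ℕ)), w ∈ R → L.Nodup ∧
        L.length = search E (weight z) (w, R.filter fun u => !decide (u = w), [(t, 1)]) ∧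
        ∀ P, P ∈ L ↔ IsPathFrom T z P w (R.filter fun u => !decide (u = w)) t := by
      intro w t
      by_cases hw : w ∈ R
      · obtain ⟨L, hL⟩ := ih w (R.filter fun u => !decide (u = w)) t
          ((length_filter_ne_lt hw).trans_le (by omega)) (hR.filter _) (notMem_filter_ne R w)
        exact ⟨L, fun _ => hL⟩
      · exact ⟨[], fun h => absurd h hw⟩
    choose L hL using h1
    let edges : V → List (V × V × ℕ) := fun w =>
      (E.filter (joins v w)).filter fun e => decide (t ≤ e.2.2)
    refine ⟨(if v = z then [[]] else []) ++ (nextVertices E v R).flatMap fun w =>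
      (edges w).flatMap fun e => (L w e.2.2).map ((s(v, w), e.2.2) :: ·), ?_, ?_, ?_⟩
    · rw [List.nodup_append]
      refine ⟨by split <;> simp, ?_, ?_⟩
      · rw [List.nodup_flatMap]
        constructor
        · intro w hw
          have hwR := (exists_of_mem_nextVertices hw).1
          rw [List.nodup_flatMap]
          refine ⟨fun e he => (hL w _ hwR).1.map List.cons_injective, ?_⟩
          have hnd : ((edges w).map fun e => (s(e.1, e.2.1), e.2.2)).Nodup :=
            hE.sublist ((List.filter_sublist.trans List.filter_sublist).map _)
          rw [List.Nodup, List.pairwise_map] at hnd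
          refine hnd.imp_of_mem fun {e e'} he he' hne => ?_
          rw [Function.onFun, List.disjoint_left]
          intro P h1 h2
          obtain ⟨P₁, -, rfl⟩ := List.mem_map.1 h1
          obtain ⟨P₂, -, h⟩ := List.mem_map.1 h2
          rw [List.cons_eq_cons] at h
          have he1 := joins_iff.1 (List.mem_filter.1 (List.mem_of_mem_filter he)).2
          have he2 := joins_iff.1 (List.mem_filter.1 (List.mem_of_mem_filter he')).2
          exact hne (Prod.ext (he1.trans he2.symm) (Prod.ext_iff.1 h.1).2.symm)
        · refine (hR.filter _).pairwise_of_forall_ne fun w hw w' hw' hne => ?_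
          rw [Function.onFun, List.disjoint_left]
          intro P h1 h2
          obtain ⟨e₁, -, h1⟩ := List.mem_flatMap.1 h1
          obtain ⟨P₁, -, rfl⟩ := List.mem_map.1 h1
          obtain ⟨e₂, -, h2⟩ := List.mem_flatMap.1 h2
          obtain ⟨P₂, -, h⟩ := List.mem_map.1 h2
          rw [List.cons_eq_cons] at h
          exact hne (Sym2.congr_right.1 (Prod.ext_iff.1 h.1).1).symm
      · intro P hP P' hP'
        obtain ⟨w, -, h⟩ := List.mem_flatMap.1 hP'
        obtain ⟨e, -, h⟩ := List.mem_flatMap.1 h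
        obtain ⟨Q, -, rfl⟩ := List.mem_map.1 h
        rintro rfl
        split at hP <;> simp at hP
    · rw [search_eq, List.length_append, List.length_flatMap, children, List.map_map]
      congr 1
      · by_cases h : v = z <;> simp [weight, h]
      · refine congrArg _ (List.map_congr_left fun w hw => ?_)
        have hwR := (exists_of_mem_nextVertices hw).1
        rw [Function.comp, search_weight_linear E z _ _ _ _ (Nat.lt_succ_self _), extend,
          List.length_flatMap, List.map_map]
        simp only [edges, Function.comp_def, List.length_map, (hL w _ hwR).2.1]
        induction E.filter (joins v w) with
        | nil => rfl
        | cons e l ihl => by_cases h : t ≤ e.2.2 <;> simp [h] at ihl ⊢ <;> exact ihl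
    · intro P
      rw [List.mem_append]
      cases P with
      | nil => by_cases h : v = z <;> simp [IsPathFrom, h]
      | cons e P =>
        have h0 : e :: P ∉ (if v = z then [[]] else [] : List (List (Sym2 V × ℕ))) := by
          split <;> simp
        simp only [h0, false_or, IsPathFrom]
        constructor
        · intro h
          obtain ⟨w, hw, h⟩ := List.mem_flatMap.1 h
          obtain ⟨e', he', h⟩ := List.mem_flatMap.1 h
          obtain ⟨Q, hQ, h⟩ := List.mem_map.1 h
          obtain ⟨rfl, rfl⟩ := List.cons_eq_cons.1 h
          have hwR := (exists_of_mem_nextVertices hw).1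
          obtain ⟨he1, he2⟩ := List.mem_filter.1 he'
          obtain ⟨he1, he3⟩ := List.mem_filter.1 he1
          refine ⟨w, hwR, rfl, (hT _).1 (List.mem_map.2 ⟨e', he1, ?_⟩), by simpa using he2,
            ((hL w _ hwR).2.2 Q).1 hQ⟩
          rw [joins_iff.1 he3]
        · rintro ⟨w, hwR, he, heT, ht, h⟩
          obtain ⟨e', he', rfl⟩ := List.mem_map.1 ((hT e).2 heT)
          have hmem : e' ∈ E.filter (joins v w) := List.mem_filter.2 ⟨he', joins_iff.2 he⟩
          refine List.mem_flatMap.2 ⟨w, List.mem_filter.2 ⟨hwR, ?_⟩, List.mem_flatMap.2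
            ⟨e', List.mem_filter.2 ⟨hmem, by simpa using ht⟩, List.mem_map.2
              ⟨P, ((hL w _ hwR).2.2 P).2 h, ?_⟩⟩⟩
          · rw [Bool.not_eq_true', ← Bool.not_eq_true, List.isEmpty_iff]
            exact List.ne_nil_of_mem hmem
          · rw [← he]

/-- The search from the start vertex through all other vertices yields the number of temporal
paths. -/
theorem search_eq_numTemporalPaths (G : TemporalGraph V) {E : List (V × V × ℕ)}
    (hE : (E.map fun e => (s(e.1, e.2.1), e.2.2)).Nodup)
    (hT : ∀ e, e ∈ E.map (fun e => (s(e.1, e.2.1), e.2.2)) ↔ e ∈ G.timeEdges) (s z : V)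
    (R : List V) (hR : R.Nodup) (hs : ∀ v, v ∈ R ↔ v ≠ s) :
    search E (weight z) (s, R, [(0, 1)]) = G.numTemporalPaths s z := by
  have hs' : s ∉ R := fun h => (hs s).1 h rfl
  obtain ⟨L, h1, h2, h3⟩ := exists_paths hE hT z _ s R 0 (Nat.lt_succ_self _) hR hs'
  rw [← h2, ← List.toFinset_card_of_nodup h1, TemporalGraph.numTemporalPaths,
    ← Set.ncard_coe_finset]
  congr 1
  ext P
  rw [Finset.mem_coe, List.mem_toFinset, h3, isPathFrom_iff _ _ _ _ _ _ hs']
  refine and_congr Iff.rfl (and_congr (exists_congr fun f => and_congr_right fun hf0 =>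
    and_congr Iff.rfl (and_congr_right fun hfi => ?_)) ?_)
  · refine and_iff_right fun i => (hs _).2 fun h => ?_
    rw [← hf0] at h
    exact absurd (hfi h) (Fin.succ_ne_zero i)
  · cases P <;> simp

end PathSearch

namespace StackMachine

open Computability Turing Function PathSearch

/-! ### Input and output -/

/-- The bits of the last number of a word that is being read from its end, and the numbers that
have been completed, each by the comma that precedes it. -/
def parse (w : List Γ') : List Bool × List (List Bool) :=
  w.foldr (fun a x => match a with
    | .bit b => (b :: x.1, x.2)
    | .comma => ([], x.1 :: x.2)
    | _ => x) ([], [])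

/-- The bits that stand for a symbol of the input on the stack `left`. -/
def mark : Γ' → List Bool
  | .bit b => [true, b]
  | .comma => [false]
  | _ => []

/-- Move the input to the stack `left`, thereby reversing it. -/
def readInput : Program :=
  .loop .input fun
    | .bit b => .seq (.push .left b) (.push .left true)
    | .comma => .push .left false
    | _ => .skip

theorem exec_readInput (w : List Γ') (m l r c o : List Bool) :
    Exec readInput (contents w m l r c o)
      (contents [] m (w.foldl (fun l a => mark a ++ l) l) r c o) (3 * w.length + 1) := by
  induction w generalizing l with
  | nil => exact .loop_nil rfl
  | cons a w ih =>
    have h : Exec (match a with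
        | .bit b => .seq (.push .left b) (.push .left true)
        | .comma => .push .left false
        | _ => .skip) (contents w m l r c o) (contents w m (mark a ++ l) r c o) 2 := by
      cases a with
      | bit b => exact .seq (exec_push_left ..) (exec_push_left ..)
      | comma => exact (exec_push_left ..).mono (by omega)
      | _ => exact (Exec.skip _).mono (by omega)
    exact (exec_loop_input h (ih (mark a ++ l))).mono (by rw [List.length_cons]; omega)

/-- Read the reversed input off the stack `left`. Prefixing to the main stack makes `cur` and
`done`, the two topmost values there, into `b :: cur` and `done` or into `[]` and `cur :: done`. -/
def parseLeft : Program :=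
  .loop .left fun
    | true => .pop .left fun
      | some true => pushWord [true, true, false, false]
      | _ => pushWord [true, false]
    | false => pushWord [false, true]

theorem exec_parseLeft (w u : List Γ') :
    Exec parseLeft
      (contents [] (word (parse u).1 ++ word (parse u).2) (w.foldl (fun l a => mark a ++ l) [])
        [] [] [])
      (mainOnly (word (parse (w ++ u)).1 ++ word (parse (w ++ u)).2)) (8 * w.length + 1) := by
  induction w using List.reverseRecOn generalizing u with
  | nil => exact .loop_nil rfl
  | append_singleton w a ih =>
    have h := ih (a :: u)
    rw [List.foldl_append, List.append_assoc, List.length_append]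
    rw [List.singleton_append]
    generalize w.foldl (fun l a => mark a ++ l) [] = l at h ⊢
    have hpush : ∀ x m : List Bool, Exec (pushWord x) (contents [] m l [] [] [])
        (contents [] (x ++ m) l [] [] []) (x.length + 1) := by
      intro x m
      induction x with
      | nil => exact .skip _
      | cons b x ih => exact .seq ih (exec_push_main ..)
    cases a with
    | bit b =>
      cases b with
      | false =>
        exact (exec_loop_left (exec_pop_left (hpush [true, false] _)) h).mono
          (by simp only [List.length_cons, List.length_nil]; omega)
      | true =>
        exact (exec_loop_left (exec_pop_left (hpush [true, true, false, false] _)) h).mono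
          (by simp only [List.length_cons, List.length_nil]; omega)
    | comma =>
      exact (exec_loop_left (hpush [false, true] _) h).mono
        (by simp only [List.length_cons, List.length_nil]; omega)
    | _ => exact h.mono (by omega)

/-- Read the input, leaving its contents as a value on the main stack. -/
def parseProgram : Program :=
  .seq readInput (.seq (pushWord [false, false]) (.seq parseLeft (.push .main true)))

theorem exec_parseProgram (w : List Γ') :
    Exec parseProgram (contents w [] [] [] [] []) (mainOnly (word (parse w)))
      (11 * w.length + 7) := by
  have h1 := exec_readInput w [] [] [] [] []
  have h2 : Exec (pushWord [false, false])
      (contents [] [] (w.foldl (fun l a => mark a ++ l) []) [] [] [])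
      (contents [] [false, false] (w.foldl (fun l a => mark a ++ l) []) [] [] []) 3 :=
    (Exec.seq (.seq (.skip _) (exec_push_main ..)) (exec_push_main ..))
  have h3 := exec_parseLeft w []
  rw [List.append_nil] at h3
  exact (h1.seq (h2.seq (h3.seq (exec_push_main ..)))).mono (by omega)

theorem size_parse_le (w : List Γ') : size (parse w) ≤ 4 * w.length + 3 := by
  induction w with
  | nil => rfl
  | cons a w ih =>
    rw [size_prod] at ih
    rw [List.length_cons]
    cases a with
    | bit b =>
      have := size_bool_le b
      change size (b :: (parse w).1, (parse w).2) ≤ _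
      rw [size_mk, size_cons]
      omega
    | comma =>
      change size (([] : List Bool), (parse w).1 :: (parse w).2) ≤ _
      rw [size_mk, size_cons, size_nil]
      omega
    | _ =>
      change size (parse w) ≤ _
      rw [size_prod]
      omega

theorem parse_bits (l : List Bool) (w : List Γ') :
    parse (l.map Γ'.bit ++ w) = (l ++ (parse w).1, (parse w).2) := by
  induction l with
  | nil => rfl
  | cons b l ih =>
    change (b :: (parse (l.map Γ'.bit ++ w)).1, (parse (l.map Γ'.bit ++ w)).2) = _
    rw [ih]
    rfl

theorem parse_numbers (l : List ℕ) :
    parse (l.flatMap fun k => Γ'.comma :: TemporalPathInstance.binary k) =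
      ([], l.map encodeNat) := by
  induction l with
  | nil => rfl
  | cons k l ih =>
    rw [List.flatMap_cons, List.cons_append]
    change ([], (parse (TemporalPathInstance.binary k ++ _)).1 ::
      (parse (TemporalPathInstance.binary k ++ _)).2) = _
    rw [TemporalPathInstance.binary, parse_bits, ih, List.append_nil]
    rfl

theorem word_map_encodeNat (l : List ℕ) : word (l.map encodeNat) = word l := by
  induction l with
  | nil => rfl
  | cons k l ih => rw [List.map_cons, word_cons, word_cons, ih, word_nat]

theorem word_parse_encode (I : TemporalPathInstance) :
    word (parse I.encode) = word (List.replicate I.n true,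
      [I.graph.lifetime, (I.s : ℕ), (I.z : ℕ)] ++
        I.listing.flatMap fun e => [(e.1 : ℕ), (e.2.1 : ℕ), e.2.2]) := by
  rw [TemporalPathInstance.encode, ← List.map_replicate, parse_bits, parse_numbers, word_prod,
    word_prod, word_map_encodeNat, List.append_nil]

/-- Output the bits of the number on the main stack. -/
def emit : Program :=
  .seq (.push .counter true) (.seq
    (.loop .counter fun _ => .pop .main fun
      | some true => .pop .main fun
        | some true => .pop .main fun _ => .pop .main fun _ =>
            .seq (.push .left true) (.push .counter true)
        | _ => .seq (.push .left false) (.push .counter true)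
      | _ => .skip)
    (.loop .left fun b => .push .output b))

theorem exec_emit (n : ℕ) :
    Exec emit (mainOnly (word n)) (contents [] [] [] [] [] (encodeNat n)) (9 * size n) := by
  have h1 : ∀ l u : List Bool, Exec (.loop .counter fun _ => .pop .main fun
      | some true => .pop .main fun
        | some true => .pop .main fun _ => .pop .main fun _ =>
            .seq (.push .left true) (.push .counter true)
        | _ => .seq (.push .left false) (.push .counter true)
      | _ => .skip) (contents [] (word l) u [] [true] [])
      (contents [] [] (l.reverse ++ u) [] [] []) (7 * l.length + 4) := by
    intro l
    induction l with
    | nil =>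
      intro u
      exact (exec_loop_counter (S := contents [] [] u [] [] []) (exec_pop_main (.skip _))
        (.loop_nil rfl)).mono (by simp)
    | cons b l ih =>
      intro u
      have h := ih (b :: u)
      rw [List.reverse_cons, List.append_assoc]
      cases b with
      | false =>
        exact (exec_loop_counter (exec_pop_main (exec_pop_main
          ((exec_push_left ..).seq (exec_push_counter ..)))) h).mono
          (by rw [List.length_cons]; omega)
      | true =>
        exact (exec_loop_counter (exec_pop_main (exec_pop_main (exec_pop_main (exec_pop_main
          ((exec_push_left ..).seq (exec_push_counter ..)))))) h).mono
          (by rw [List.length_cons]; omega)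
  have h2 : ∀ l o : List Bool, Exec (.loop .left fun b => .push .output b)
      (contents [] [] l [] [] o) (contents [] [] [] [] [] (l.reverse ++ o))
      (2 * l.length + 1) := by
    intro l
    induction l with
    | nil => intro o; exact .loop_nil rfl
    | cons b l ih =>
      intro o
      have h := exec_loop_left (exec_push_output [] [] l [] [] o b) (ih (b :: o))
      rw [List.reverse_cons, List.append_assoc]
      exact h.mono (by rw [List.length_cons]; omega)
  have h3 := h1 (encodeNat n) []
  have h4 := h2 (encodeNat n).reverse []
  have h5 := length_lt_size (encodeNat n)
  rw [List.append_nil] at h3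
  rw [List.reverse_reverse, List.append_nil] at h4
  rw [size_nat]
  refine ((exec_push_counter ..).seq (h3.seq h4)).mono ?_
  rw [List.length_reverse]
  omega

end StackMachine

/-! ### The algorithm -/

namespace PathSearch

open StackMachine PolyTime

/-- Adding a number in front of a list of numbers that is being cut into triples from its end;
`x.1` holds the numbers of the unfinished triple. -/
def groupStep (k : ℕ) (x : List ℕ × List (ℕ × ℕ × ℕ)) : List ℕ × List (ℕ × ℕ × ℕ) :=
  if x.1.tail.isEmpty then (k :: x.1, x.2)
  else ([], (k, x.1.headD 0, x.1.tail.headD 0) :: x.2)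

theorem size_groupStep_le (k : ℕ) (x : List ℕ × List (ℕ × ℕ × ℕ)) :
    size (groupStep k x) ≤ size x + (size k + 5) := by
  obtain ⟨l, o⟩ := x
  rcases l with - | ⟨a, - | ⟨b, l⟩⟩
  · change size ([k], o) ≤ _
    simp only [size_mk, size_cons, size_nil]
    omega
  · change size ([k, a], o) ≤ _
    simp only [size_mk, size_cons, size_nil]
    omega
  · change size (([] : List ℕ), (k, a, b) :: o) ≤ _
    simp only [size_mk, size_cons, size_nil]
    omega

/-- Cut a list of numbers into triples. -/
def triples (l : List ℕ) : List (ℕ × ℕ × ℕ) := (l.foldr groupStep ([], [])).2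

theorem triples_flatMap {α : Type} (f : α → ℕ × ℕ × ℕ) (l : List α) :
    triples (l.flatMap fun a => [(f a).1, (f a).2.1, (f a).2.2]) = l.map f := by
  have : (l.flatMap fun a => [(f a).1, (f a).2.1, (f a).2.2]).foldr groupStep ([], []) =
      ([], l.map f) := by
    induction l with
    | nil => rfl
    | cons a l ih =>
      rw [List.flatMap_cons, List.foldr_append, ih]
      rfl
  rw [triples, this]

theorem polyTime_triples {α : Type} [Data α] {l : α → List ℕ} (hl : PolyTime l) :
    PolyTime fun a => triples (l a) := by
  have hb : PolyTime fun x : α × ℕ × List ℕ × List (ℕ × ℕ × ℕ) => x.2.2.1 := snd.snd'.fst'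
  have ho : PolyTime fun x : α × ℕ × List ℕ × List (ℕ × ℕ × ℕ) => x.2.2.2 := snd.snd'.snd'
  exact (hl.foldr (f := fun _ => groupStep) (const ([], []))
    (hb.tail.isEmpty.ite ((snd.fst'.cons hb).pair ho) ((const []).pair
      ((snd.fst'.pair ((hb.headD (const 0)).pair (hb.tail.headD (const 0)))).cons ho)))
    (g := fun n => n + 5) (by fun_prop) (fun a b h => Nat.add_le_add_right h 5)
    fun a k x => (size_groupStep_le k x).trans (by omega)).snd'

theorem foldl_count (l : List Bool) :
    l.foldl (fun (x : ℕ × List ℕ) _ => (x.1 + 1, x.1 :: x.2)) (0, []) =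
      (l.length, (List.range l.length).reverse) := by
  induction l using List.reverseRecOn with
  | nil => rfl
  | append_singleton l b ih => simp [List.foldl_append, ih, List.range_succ]

theorem polyTime_range {α : Type} [Data α] {l : α → List Bool} (hl : PolyTime l) :
    PolyTime fun a => (List.range (l a).length).reverse := by
  obtain ⟨_, t, ht, -, htl⟩ := hl.elim
  have h := foldl_of_size_le (f := fun _ (x : ℕ × List ℕ) (_ : Bool) => (x.1 + 1, x.1 :: x.2)) hl
    (const (0, [])) ((snd.fst'.fst'.add (const 1)).pair (snd.fst'.fst'.cons snd.fst'.snd'))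
    (g := fun n => (4 * t n + 1) + (t n * (4 * t n + 1 + 1) + 1) + 1) (by fun_prop)
    fun a l₁ l₂ h => by
      have h1 : l₁.length ≤ t (size a) := by
        have h1 := length_lt_size (l a)
        have h2 := (htl a).1
        rw [h, List.length_append] at h1
        rw [h] at h2
        omega
      have h2 : ∀ k ≤ l₁.length, size k ≤ 4 * t (size a) + 1 := fun k hk =>
        (size_nat_le (k.lt_two_pow_self)).trans (by omega)
      rw [foldl_count, size_mk]
      refine Nat.succ_le_succ (add_le_add (h2 _ le_rfl) ((size_list_le fun k hk =>
        h2 k ?_).trans ?_))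
      · simpa using (List.mem_range.1 (List.mem_reverse.1 hk)).le
      · rw [List.length_reverse, List.length_range]
        exact Nat.add_le_add_right (Nat.mul_le_mul_right _ h1) 1
  exact h.snd'.of_eq fun a => by rw [foldl_count]

/-- The initial state of the search, from the input. -/
def initialState (x : List Bool × List ℕ) : (List (ℕ × ℕ × ℕ) × ℕ) × ℕ × List (Item ℕ) :=
  (((triples x.2).tail, ((triples x.2).headD (0, 0, 0)).2.2), 0,
    [(((triples x.2).headD (0, 0, 0)).2.1, (List.range x.1.length).reverse.filter fun v =>
      !decide (v = ((triples x.2).headD (0, 0, 0)).2.1), [(0, 1)])])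

theorem polyTime_initialState : PolyTime initialState := by
  have ht : PolyTime fun x : List Bool × List ℕ => triples x.2 := polyTime_triples snd
  have hh := ht.headD (const (0, 0, 0))
  refine (ht.tail.pair hh.snd'.snd').pair ((const 0).pair
    ((hh.snd'.fst'.pair (PolyTime.pair ?_ (const [(0, 1)]))).cons (const [])))
  exact (polyTime_range fst).filter
    (f := fun x v => !decide (v = ((triples x.2).headD (0, 0, 0)).2.1))
    (snd.eq (hh.snd'.fst'.comp fst)).not

end PathSearch

namespace TemporalPathInstance

open StackMachine PathSearch PolyTime Computability

variable (I : TemporalPathInstance)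

/-- The time-edges, as triples of numbers. -/
def edgeList : List (ℕ × ℕ × ℕ) := I.listing.map fun e => ((e.1 : ℕ), (e.2.1 : ℕ), e.2.2)

/-- The vertices other than `s`, as numbers. -/
def otherVertices : List ℕ :=
  (List.range I.n).reverse.filter fun v => !decide (v = (I.s : ℕ))

/-- The root of the search tree: the path of length `0`, with the empty temporal path, which counts
as one with label `0`. -/
def root : Item ℕ := ((I.s : ℕ), I.otherVertices, [(0, 1)])

theorem initialState_eq : initialState (List.replicate I.n true,
      [I.graph.lifetime, (I.s : ℕ), (I.z : ℕ)] ++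
        I.listing.flatMap fun e => [(e.1 : ℕ), (e.2.1 : ℕ), e.2.2]) =
    ((I.edgeList, (I.z : ℕ)), 0, [I.root]) := by
  have h : triples ([I.graph.lifetime, (I.s : ℕ), (I.z : ℕ)] ++
      I.listing.flatMap fun e => [(e.1 : ℕ), (e.2.1 : ℕ), e.2.2]) =
      (I.graph.lifetime, (I.s : ℕ), (I.z : ℕ)) :: I.edgeList := by
    have := triples_flatMap (fun e => e) ((I.graph.lifetime, (I.s : ℕ), (I.z : ℕ)) :: I.edgeList)
    rw [List.map_id', List.flatMap_cons, edgeList, List.flatMap_map] at this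
    exact this
  simp only [initialState, h, List.length_replicate]
  rfl

/-- The vertices other than `s`, in the order of `otherVertices`. -/
def otherVertices' : List (Fin I.n) :=
  (List.finRange I.n).reverse.filter fun v => !decide (v = I.s)

theorem map_otherVertices' : I.otherVertices'.map Fin.val = I.otherVertices := by
  rw [otherVertices, otherVertices', ← List.map_coe_finRange_eq_range, ← List.map_reverse,
    List.filter_map]
  simp only [Function.comp_def, Fin.val_inj]

theorem mem_otherVertices' (v : Fin I.n) : v ∈ I.otherVertices' ↔ v ≠ I.s := by
  simp [otherVertices']

theorem nodup_otherVertices' : I.otherVertices'.Nodup :=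
  (List.nodup_reverse.2 (List.nodup_finRange _)).filter _

/-- The search among numbers amounts to a search among the vertices of the graph. -/
theorem search_root (f : Item (Fin I.n) → ℕ) (g : Item ℕ → ℕ)
    (h : ∀ x : Item (Fin I.n), g ((x.1 : ℕ), x.2.1.map Fin.val, x.2.2) = f x) :
    search I.edgeList g I.root = search I.listing f (I.s, I.otherVertices', [(0, 1)]) := by
  rw [← search_map Fin.val_injective I.listing h _ _ (Nat.lt_succ_self _)]
  simp only [map_otherVertices']
  rfl

theorem search_weight_root : search I.edgeList (weight (I.z : ℕ)) I.root = I.count := by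
  rw [I.search_root (weight I.z) _ fun x => by simp [weight, Fin.val_inj],
    search_eq_numTemporalPaths I.graph I.nodup I.mem_iff I.s I.z _ I.nodup_otherVertices'
      I.mem_otherVertices']
  rfl

theorem search_one_root_le : search I.edgeList (fun _ => 1) I.root ≤
    I.n * 3 ^ (2 ^ I.feedbackEdgeNumber - 1) := by
  rw [I.search_root (fun _ => 1) _ fun _ => rfl]
  refine (search_one_le I.graph.underlying (fun e he => ?_) _ _ _ I.nodup_otherVertices'
    fun h => (I.mem_otherVertices' _).1 h rfl).trans_eq (by rw [Fintype.card_fin]; rfl)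
  have h := (I.mem_iff _).1 (List.mem_map_of_mem he)
  rw [TemporalGraph.underlying, SimpleGraph.fromEdgeSet_adj]
  exact ⟨⟨_, h⟩, fun h' => I.graph.not_isDiag _ h (Sym2.mk_isDiag_iff.2 h')⟩

theorem n_le_length_encode : I.n ≤ I.encode.length := by
  simp [encode]

/-- A program that counts the temporal paths, within a time polynomial in the length of the input
and the number of nodes of the search tree. -/
theorem exists_count_program : ∃ (p : Program) (c : ℕ), ∀ (I : TemporalPathInstance) (k : ℕ),
    I.encode.length ≤ k → search I.edgeList (fun _ => 1) I.root + 1 ≤ k →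
    Exec p (contents I.encode [] [] [] [] []) (contents [] [] [] [] [] (encodeNat I.count))
      ((k + 2) ^ c) := by
  obtain ⟨p₁, t₁, ht₁, ht₁', h₁⟩ := polyTime_initialState.elim
  obtain ⟨p₂, q, t₂, ⟨c, hq⟩, ht₂, ht₂', h₂⟩ := exists_search_program
  obtain ⟨p₃, t₃, ht₃, ht₃', h₃⟩ :=
    (snd.fst' : PolyTime fun x : (List (ℕ × ℕ × ℕ) × ℕ) × ℕ × List (Item ℕ) => x.2.1).elim
  obtain ⟨d, hd⟩ : PolyBounded fun k => 11 * k + 7 + (t₁ (4 * k + 3) +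
      (k * t₂ ((t₁ (4 * k + 3) + 2) ^ c * k) + (t₃ ((t₁ (4 * k + 3) + 2) ^ c * k) +
        9 * t₃ ((t₁ (4 * k + 3) + 2) ^ c * k)))) := by fun_prop
  refine ⟨.seq parseProgram (.seq p₁ (.seq p₂ (.seq p₃ emit))), d, fun I k hI hN => ?_⟩
  have e₀ := exec_parseProgram I.encode
  have hsize : size (parse I.encode) ≤ 4 * k + 3 :=
    (size_parse_le _).trans (by omega)
  rw [size, word_parse_encode] at hsize
  rw [word_parse_encode] at e₀
  obtain ⟨s₁, e₁⟩ := h₁ (List.replicate I.n true,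
      [I.graph.lifetime, (I.s : ℕ), (I.z : ℕ)] ++
        I.listing.flatMap fun e => [(e.1 : ℕ), (e.2.1 : ℕ), e.2.2])
  have e₁ := e₁ []
  have hs₁ := s₁.trans (ht₁' hsize)
  rw [initialState_eq] at e₁ hs₁
  obtain ⟨s₂, e₂⟩ := h₂ I.edgeList I.s I.z I.otherVertices []
  have hB := Nat.mul_le_mul ((hq _).trans
    (Nat.pow_le_pow_left (Nat.add_le_add_right hs₁ 2) c)) hN
  have hs₂ := s₂.trans hB
  obtain ⟨s₃, e₃⟩ := h₃ ((I.edgeList, (I.z : ℕ)), I.count, ([] : List (Item ℕ)))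
  have e₃ := e₃ []
  have e₄ := exec_emit I.count
  rw [show search I.edgeList (weight (I.z : ℕ)) ((I.s : ℕ), I.otherVertices, [(0, 1)]) = I.count
    from I.search_weight_root] at e₂ hs₂
  rw [List.append_nil, List.append_nil] at e₁ e₂ e₃
  have e := e₀.seq (e₁.seq (e₂.seq (e₃.seq e₄)))
  refine e.mono (le_trans ?_ (hd k))
  exact add_le_add (by omega) (add_le_add (ht₁' hsize) (add_le_add (Nat.mul_le_mul hN (ht₂' hB))
    (add_le_add (ht₃' hs₂) (Nat.mul_le_mul_left 9 (s₃.trans (ht₃' hs₂))))))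

end TemporalPathInstance

theorem computable_threePow (c : ℕ) : Computable fun k : ℕ => (3 ^ 2 ^ k) ^ c := by
  have h : Primrec₂ fun a b : ℕ => a ^ b := Primrec₂.unpaired'.1 Nat.Primrec.pow
  exact (h.comp (h.comp (.const 3) (h.comp (.const 2) .id)) (.const c)).to_comp

theorem theorem6 :
    FixedParameterTractable TemporalPathInstance.encode
      TemporalPathInstance.count TemporalPathInstance.feedbackEdgeNumber := by
  obtain ⟨p, c, hp⟩ := TemporalPathInstance.exists_count_program
  refine ⟨fun k => (3 ^ 2 ^ k) ^ (c + 1), (Polynomial.X + 3) ^ (c + 1), StackMachine.computer p,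
    computable_threePow _, fun I => ?_⟩
  let n := I.encode.length
  let g := 3 ^ 2 ^ I.feedbackEdgeNumber
  have hg : 1 ≤ g := Nat.one_le_pow _ _ (by norm_num)
  have h := (hp I (g * (n + 1)) ?_ ?_).outputsInTime
  · obtain ⟨h⟩ := h
    refine ⟨⟨h.toEvalsTo, h.steps_le_m.trans ?_⟩⟩
    have h1 : (g * (n + 1) + 2) ^ c ≤ (g * (n + 3)) ^ c :=
      Nat.pow_le_pow_left (by rw [mul_add, mul_add]; omega) c
    have h2 : 2 ≤ g * (n + 3) := (by omega : 2 ≤ n + 3).trans (Nat.le_mul_of_pos_left _ hg)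
    have h3 : 1 ≤ (g * (n + 3)) ^ c := Nat.one_le_pow _ _ (by omega)
    have h4 := Nat.mul_le_mul_left ((g * (n + 3)) ^ c) h2
    simp only [Polynomial.eval_pow, Polynomial.eval_add, Polynomial.eval_X,
      Polynomial.eval_ofNat]
    change (g * (n + 1) + 2) ^ c + 1 ≤ g ^ (c + 1) * (n + 3) ^ (c + 1)
    rw [← mul_pow, pow_succ]
    omega
  · exact (Nat.le_succ n).trans (Nat.le_mul_of_pos_left _ hg)
  · have h1 := I.search_one_root_le
    have h2 : I.n * 3 ^ (2 ^ I.feedbackEdgeNumber - 1) ≤ n * g :=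
      Nat.mul_le_mul I.n_le_length_encode (Nat.pow_le_pow_right (by norm_num) (Nat.sub_le _ _))
    rw [mul_add, mul_comm g n]
    omega
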